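/- Throughout, $(a,b,c)$ with $a>0$ denotes the class, under proper ($SL(2,\mathbb Z)$) equivalence, of the primitive positive definite integral binary quadratic form $ax^2+bxy+cy^2$ of discriminant $b^2-4ac<0$, and its theta series is the formal power series $$(a,b,c,q)=\sum_{x,y\in\mathbb Z}q^{ax^2+bxy+cy^2}.$$ For $m\ge 1$ and $r\ge 0$ put $P_{m,r}\sum_{n\ge0}a(n)q^n=\sum_{n\equiv r\,(\mathrm{mod}\ m)}a(n)q^n$. The assigned characters of a discriminant $\Delta<0$ are the Legendre symbols $\left(\frac{r}{\ell}\right)$ for the odd primes $\ell\mid\Delta$, together with, when $\Delta=-4n$: $\left(\frac{-1}{r}\right)$ if $n\equiv1\pmod 4$ or $n\equiv4\pmod 8$; $\left(\frac{-2}{r}\right)$ if $n\equiv2\pmod 8$; $\left(\frac{2}{r}\right)$ if $n\equiv6\pmod 8$; both $\left(\frac{-1}{r}\right)$ and $\left(\frac{2}{r}\right)$ if $n\equiv0\pmod 8$; and no further one if $n\equiv3\pmod4$. Two classes of discriminant $\Delta$ lie in the same genus if every assigned character of $\Delta$ takes the same value on the integers coprime to $\Delta$ represented by the one and by the other. A genus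 represents an integer if some class in it does. Let $p$ be a prime, let $g$ be a genus of discriminant $\Delta<0$ and $G$ a genus of discriminant $\Delta p^2$. Say that $G$ corresponds to $g$ if $\chi(r_1)=\chi(r_2)$ for all assigned characters $\chi$ of $\Delta$, where $r_1,r_2$ are integers coprime to $\Delta p^2$ represented by $g$ and $G$ respectively. Let $w=3,2,1$ according as $\Delta=-3$, $\Delta=-4$, $\Delta<-4$. Let $t=2$ if $\Delta\equiv0\pmod{16}$, and for $\Delta\not\equiv0\pmod{16}$ let $t=0$ if $\Delta$ is odd and $t=1$ if $\Delta$ is even. **Corollary.** If $G$ corresponds to $g$, and $r$ is any integer coprime to $\Delta p^2$ and represented by $G$, then for $p$ odd $$w\sum_{(A,B,C)\in G}(A,B,C,q)=\sum_{(a,b,c)\in g}\left[w\frac{|G|}{|g|}(a,b,c,q^{p^2})+\sum_{i=1}^{p-1}\frac{\left(\frac{ri}{p}\right)+1}{2}P_{p,i}(a,b,c,q)\right],$$ and for $p=2$ $$w\sum_{(A,B,C)\in G}(A,B,C,q)=\sum_{(a,b,c)\in g}\left[w\frac{|G|}{|g|}(a,b,c,q^{4})+P_{2^{t+1},r}(a,b,c,q)\right].$$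 -/

import Mathlib

namespace GenusTheta

/-- The integral binary quadratic form `a x² + b x y + c y²`. -/
@[ext]
structure BQForm where
  a : ℤ
  b : ℤ
  c : ℤ

namespace BQForm

/-- The value `a x² + b x y + c y²`. -/
def eval (f : BQForm) (x y : ℤ) : ℤ := f.a * x ^ 2 + f.b * x * y + f.c * y ^ 2

/-- The discriminant `b² - 4 a c`. -/
def disc (f : BQForm) : ℤ := f.b ^ 2 - 4 * f.a * f.c

/-- The greatest common divisor of the three coefficients is `1`. -/
def IsPrimitive (f : BQForm) : Prop := Int.gcd (Int.gcd f.a f.b) f.c = 1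

/-- `f` and `f'` are properly equivalent: `f'(x, y) = f(α x + β y, γ x + δ y)` for some matrix
`!![α, β; γ, δ]` in `SL(2, ℤ)`. -/
def Equivalent (f f' : BQForm) : Prop :=
  ∃ M : Matrix.SpecialLinearGroup (Fin 2) ℤ,
    ∀ x y : ℤ, f'.eval x y = f.eval (M 0 0 * x + M 0 1 * y) (M 1 0 * x + M 1 1 * y)

/-- The set of representations of `n` by `f`. -/
def repSet (f : BQForm) (n : ℤ) : Set (ℤ × ℤ) := {v | f.eval v.1 v.2 = n}

/-- The number `(a,b,c;n)` of representations of `n` by `f`. -/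
noncomputable def repCount (f : BQForm) (n : ℤ) : ℕ := (f.repSet n).ncard

theorem Equivalent.refl (f : BQForm) : f.Equivalent f := ⟨1, by simp⟩

theorem Equivalent.symm {f f' : BQForm} (h : f.Equivalent f') : f'.Equivalent f := by
  obtain ⟨M, hM⟩ := h
  have hdet : M 0 0 * M 1 1 - M 0 1 * M 1 0 = 1 := by
    have := M.det_coe
    rwa [Matrix.det_fin_two] at this
  refine ⟨M⁻¹, fun x y => ?_⟩
  simp only [Matrix.SpecialLinearGroup.coe_inv, Matrix.adjugate_fin_two, Matrix.of_apply,
    Matrix.cons_val', Matrix.cons_val_zero, Matrix.cons_val_one, Matrix.cons_val_fin_one]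
  rw [hM]
  congr 1
  · linear_combination (-x) * hdet
  · linear_combination (-y) * hdet

theorem Equivalent.trans {f f' f'' : BQForm} (h : f.Equivalent f') (h' : f'.Equivalent f'') :
    f.Equivalent f'' := by
  obtain ⟨M, hM⟩ := h
  obtain ⟨N, hN⟩ := h'
  refine ⟨M * N, fun x y => ?_⟩
  rw [hN, hM]
  simp only [Matrix.SpecialLinearGroup.coe_mul, Matrix.mul_apply, Fin.sum_univ_two]
  congr 1 <;> ring

/-- Equivalent forms represent every integer equally often. -/
theorem Equivalent.repCount_eq {f f' : BQForm} (h : f.Equivalent f') (n : ℤ) :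
    f.repCount n = f'.repCount n := by
  obtain ⟨M, hM⟩ := h
  have hdet : M 0 0 * M 1 1 - M 0 1 * M 1 0 = 1 := by
    have := M.det_coe
    rwa [Matrix.det_fin_two] at this
  refine (Set.ncard_congr
    (fun v _ => (M 0 0 * v.1 + M 0 1 * v.2, M 1 0 * v.1 + M 1 1 * v.2)) ?_ ?_ ?_).symm
  · intro v hv
    simp only [repSet, Set.mem_ofPred_eq] at hv ⊢
    rw [← hM, hv]
  · rintro ⟨x, y⟩ ⟨x', y'⟩ - - h
    simp only [Prod.mk.injEq] at h ⊢
    obtain ⟨h1, h2⟩ := h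
    constructor
    · linear_combination M 1 1 * h1 - M 0 1 * h2 + (x' - x) * hdet
    · linear_combination M 0 0 * h2 - M 1 0 * h1 + (y' - y) * hdet
  · rintro ⟨x, y⟩ hv
    simp only [repSet, Set.mem_ofPred_eq] at hv
    have e1 : M 0 0 * (M 1 1 * x - M 0 1 * y) + M 0 1 * (M 0 0 * y - M 1 0 * x) = x := by
      linear_combination x * hdet
    have e2 : M 1 0 * (M 1 1 * x - M 0 1 * y) + M 1 1 * (M 0 0 * y - M 1 0 * x) = y := by
      linear_combination y * hdet
    refine ⟨(M 1 1 * x - M 0 1 * y, M 0 0 * y - M 1 0 * x), ?_, ?_⟩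
    · simp only [repSet, Set.mem_ofPred_eq]
      rw [hM, e1, e2, hv]
    · simp only [Prod.mk.injEq]
      exact ⟨e1, e2⟩

end BQForm

/-- Primitive positive definite binary quadratic forms of discriminant `Δ`. -/
structure PrimForm (Δ : ℤ) where
  form : BQForm
  disc_eq : form.disc = Δ
  disc_neg : form.disc < 0
  a_pos : 0 < form.a
  primitive : form.IsPrimitive

/-- A positive definite form represents every integer only finitely often. -/
theorem PrimForm.finite_repSet {Δ : ℤ} (f : PrimForm Δ) (n : ℤ) : (f.form.repSet n).Finite := by
  obtain ⟨⟨a, b, c⟩, -, hneg, ha, -⟩ := f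
  simp only [BQForm.disc] at hneg ha ⊢
  have hc : 0 < c := by nlinarith [sq_nonneg b]
  refine ((Set.finite_Icc (-(4 * c * n)) (4 * c * n)).prod
    (Set.finite_Icc (-(4 * a * n)) (4 * a * n))).subset ?_
  rintro ⟨x, y⟩ h
  simp only [BQForm.repSet, BQForm.eval, Set.mem_ofPred_eq] at h
  have hx : x ^ 2 ≤ 4 * c * n := by
    nlinarith [sq_nonneg (2 * c * y + b * x), sq_nonneg x]
  have hy : y ^ 2 ≤ 4 * a * n := by
    nlinarith [sq_nonneg (2 * a * x + b * y), sq_nonneg y]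
  have key : ∀ z N : ℤ, z ^ 2 ≤ N → -N ≤ z ∧ z ≤ N := fun z N hz => by
    constructor
    · nlinarith [Int.le_self_sq (-z)]
    · nlinarith [Int.le_self_sq z]
  exact ⟨key _ _ hx, key _ _ hy⟩

instance primFormSetoid (Δ : ℤ) : Setoid (PrimForm Δ) where
  r f f' := f.form.Equivalent f'.form
  iseqv := ⟨fun _ => .refl _, fun h => h.symm, fun h h' => h.trans h'⟩

/-- `CL(Δ)`: the set of proper equivalence classes of primitive positive definite forms of
discriminant `Δ`. -/
def FormClass (Δ : ℤ) : Type := Quotient (primFormSetoid Δ)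

theorem BQForm.isUnit_of_dvd (f : BQForm) (hf : f.IsPrimitive) (d : ℤ) (h1 : d ∣ f.a)
    (h2 : d ∣ f.b) (h3 : d ∣ f.c) : IsUnit d := by
  have h := Int.dvd_coe_gcd (Int.dvd_coe_gcd h1 h2) h3
  rw [BQForm.IsPrimitive] at hf
  rw [hf] at h
  exact isUnit_of_dvd_one (by simpa using h)

theorem BQForm.isPrimitive_of (f : BQForm) (h : ∀ d : ℤ, d ∣ f.a → d ∣ f.b → d ∣ f.c → IsUnit d) :
    f.IsPrimitive := by
  have := h (Int.gcd (Int.gcd f.a f.b) f.c)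
    ((Int.gcd_dvd_left _ _).trans (Int.gcd_dvd_left _ _))
    ((Int.gcd_dvd_left _ _).trans (Int.gcd_dvd_right _ _)) (Int.gcd_dvd_right _ _)
  rw [Int.isUnit_iff] at this
  rw [BQForm.IsPrimitive]
  omega

/-- The form obtained from `f` by `x ↦ x + k y`. -/
def PrimForm.shift {Δ : ℤ} (f : PrimForm Δ) (k : ℤ) : PrimForm Δ where
  form := ⟨f.form.a, f.form.b + 2 * f.form.a * k, f.form.a * k ^ 2 + f.form.b * k + f.form.c⟩
  disc_eq := by refine Eq.trans ?_ f.disc_eq; simp only [BQForm.disc]; ring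
  disc_neg := by
    refine lt_of_eq_of_lt ?_ f.disc_neg
    simp only [BQForm.disc]; ring
  a_pos := f.a_pos
  primitive := by
    refine BQForm.isPrimitive_of _ fun d h1 h2 h3 => ?_
    simp only at h1 h2 h3
    have hb : d ∣ f.form.b := by
      have := dvd_sub h2 (h1.mul_right (2 * k))
      rwa [show f.form.b + 2 * f.form.a * k - f.form.a * (2 * k) = f.form.b by ring] at this
    have hc : d ∣ f.form.c := (dvd_add_right (dvd_add (h1.mul_right (k ^ 2)) (hb.mul_right k))).mp h3
    exact BQForm.isUnit_of_dvd _ f.primitive d h1 hb hc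

/-- The form obtained from `f` by `(x, y) ↦ (-y, x)`. -/
def PrimForm.swap {Δ : ℤ} (f : PrimForm Δ) : PrimForm Δ where
  form := ⟨f.form.c, -f.form.b, f.form.a⟩
  disc_eq := by refine Eq.trans ?_ f.disc_eq; simp only [BQForm.disc]; ring
  disc_neg := by
    refine lt_of_eq_of_lt ?_ f.disc_neg
    simp only [BQForm.disc]; ring
  a_pos := by
    have h1 := f.disc_neg
    have h2 := f.a_pos
    simp only [BQForm.disc] at h1 ⊢
    nlinarith [sq_nonneg f.form.b]
  primitive := BQForm.isPrimitive_of _ fun d h1 h2 h3 =>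
    BQForm.isUnit_of_dvd _ f.primitive d h3 (by simpa using h2) h1

theorem PrimForm.equivalent_shift {Δ : ℤ} (f : PrimForm Δ) (k : ℤ) :
    f.form.Equivalent (f.shift k).form := by
  refine ⟨⟨!![1, k; 0, 1], by simp [Matrix.det_fin_two]⟩, fun x y => ?_⟩
  simp [BQForm.eval, PrimForm.shift]
  ring

theorem PrimForm.equivalent_swap {Δ : ℤ} (f : PrimForm Δ) :
    f.form.Equivalent f.swap.form := by
  refine ⟨⟨!![0, -1; 1, 0], by simp [Matrix.det_fin_two]⟩, fun x y => ?_⟩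
  simp [BQForm.eval, PrimForm.swap]
  ring

/-- Every class contains a form with `|b| ≤ a ≤ c`. -/
theorem PrimForm.exists_reduced {Δ : ℤ} (f : PrimForm Δ) :
    ∃ f' : PrimForm Δ, f.form.Equivalent f'.form ∧
      |f'.form.b| ≤ f'.form.a ∧ f'.form.a ≤ f'.form.c := by
  induction hn : f.form.a.toNat using Nat.strong_induction_on generalizing f with
  | _ n ih =>
    have ha := f.a_pos
    obtain ⟨k, hk⟩ : ∃ k : ℤ, |f.form.b + 2 * f.form.a * k| ≤ f.form.a := by
      refine ⟨-((f.form.b + f.form.a) / (2 * f.form.a)), ?_⟩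
      have h1 := Int.emod_add_mul_ediv (f.form.b + f.form.a) (2 * f.form.a)
      have h2 := Int.emod_nonneg (f.form.b + f.form.a) (b := 2 * f.form.a) (by omega)
      have h3 := Int.emod_lt_of_pos (f.form.b + f.form.a) (b := 2 * f.form.a) (by omega)
      rw [abs_le]
      constructor <;> linarith
    by_cases hc : f.form.a ≤ (f.shift k).form.c
    · exact ⟨f.shift k, f.equivalent_shift k, hk, hc⟩
    · have hlt : (f.shift k).swap.form.a < f.form.a := not_le.mp hc
      have hpos := (f.shift k).swap.a_pos
      obtain ⟨f', h1, h2⟩ := ih _ (by omega) (f.shift k).swap rfl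
      exact ⟨f', ((f.equivalent_shift k).trans (f.shift k).equivalent_swap).trans h1, h2⟩

/-- The class number is finite. -/
instance FormClass.instFinite (Δ : ℤ) : Finite (FormClass Δ) := by
  let S : Set (PrimForm Δ) := {f | |f.form.b| ≤ f.form.a ∧ f.form.a ≤ f.form.c}
  have hS : S.Finite := by
    refine Set.Finite.of_finite_image (f := fun f : PrimForm Δ => (f.form.a, f.form.b, f.form.c))
      (((Set.finite_Icc 0 (-Δ)).prod ((Set.finite_Icc Δ (-Δ)).prod
        (Set.finite_Icc 0 (Δ ^ 2 - Δ)))).subset ?_) ?_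
    · rintro _ ⟨⟨⟨a, b, c⟩, hd, hneg, ha, hprim⟩, hred, rfl⟩
      have h1 : -a ≤ b := (abs_le.mp hred.1).1
      have h1' : b ≤ a := (abs_le.mp hred.1).2
      have h2 : a ≤ c := hred.2
      change 0 < a at ha
      change b ^ 2 - 4 * a * c = Δ at hd
      have hb : b ^ 2 ≤ a ^ 2 := by nlinarith
      have h3 : 3 * a ^ 2 ≤ -Δ := by nlinarith
      have haD : a ≤ -Δ := by nlinarith
      have hcc : c ≤ a * c := by nlinarith
      have h5 : a ^ 2 ≤ Δ ^ 2 := by nlinarith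
      have hcD : c ≤ Δ ^ 2 - Δ := by nlinarith
      exact ⟨⟨ha.le, haD⟩, ⟨by linarith, by linarith⟩, ⟨by linarith, hcD⟩⟩
    · rintro ⟨⟨a, b, c⟩, _, _, _, _⟩ - ⟨⟨a', b', c'⟩, _, _, _, _⟩ - h
      simp only [Prod.mk.injEq] at h
      obtain ⟨rfl, rfl, rfl⟩ := h
      rfl
  have : Finite S := hS
  refine Finite.of_surjective (fun f : S => (Quotient.mk _ f.1 : FormClass Δ)) fun C => ?_
  induction C using Quotient.inductionOn with
  | h f =>
    obtain ⟨f', h1, h2⟩ := f.exists_reduced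
    exact ⟨⟨f', h2⟩, Quotient.sound h1.symm⟩

/-- The theta series `(a,b,c,q) = ∑_{n ≥ 0} (a,b,c;n) qⁿ` of a class of forms, as a formal power
series in `q`. -/
noncomputable def FormClass.theta {Δ : ℤ} (C : FormClass Δ) : PowerSeries ℚ :=
  Quotient.lift (fun f : PrimForm Δ => PowerSeries.mk fun n => (f.form.repCount n : ℚ))
    (fun _ _ h => by ext n; simp [BQForm.Equivalent.repCount_eq h n]) C

/-- The class `C` represents the integer `n`. -/
def FormClass.Represents {Δ : ℤ} (C : FormClass Δ) (n : ℤ) : Prop :=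
  ∃ f : PrimForm Δ, (Quotient.mk _ f : FormClass Δ) = C ∧ ∃ x y : ℤ, f.form.eval x y = n

/-- The assigned characters of the discriminant `Δ`: the Legendre symbols `(r/ℓ)` for the odd primes
`ℓ ∣ Δ`, and those of `(-1/r)`, `(2/r)`, `(-2/r)` that belong to `Δ`. With `Δ = -4n`,
these are: `(-1/r)` for `n ≡ 1 (mod 4)` and for `n ≡ 4 (mod 8)`; `(-2/r)` for `n ≡ 2 (mod 8)`;
`(2/r)` for `n ≡ 6 (mod 8)`; both `(-1/r)` and `(2/r)` for `n ≡ 0 (mod 8)`; none for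
`n ≡ 3 (mod 4)`. -/
inductive IsAssignedCharacter (Δ : ℤ) : (ℤ → ℤ) → Prop
  | legendre (l : ℕ) [Fact l.Prime] (hl : l ≠ 2) (h : (l : ℤ) ∣ Δ) :
      IsAssignedCharacter Δ (fun r => legendreSym l r)
  | neg_one (n : ℤ) (hn : Δ = -4 * n) (h : n % 4 = 1 ∨ n % 8 = 4 ∨ n % 8 = 0) :
      IsAssignedCharacter Δ (fun r => ZMod.χ₄ r)
  | two (n : ℤ) (hn : Δ = -4 * n) (h : n % 8 = 6 ∨ n % 8 = 0) :
      IsAssignedCharacter Δ (fun r => ZMod.χ₈ r)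
  | neg_two (n : ℤ) (hn : Δ = -4 * n) (h : n % 8 = 2) :
      IsAssignedCharacter Δ (fun r => ZMod.χ₈' r)

/-- Two classes of discriminant `Δ` are in the same genus: their assigned characters, evaluated at
represented integers coprime to `Δ`, agree. -/
def SameGenus {Δ : ℤ} (C C' : FormClass Δ) : Prop :=
  ∃ r r' : ℤ, IsCoprime r Δ ∧ IsCoprime r' Δ ∧ C.Represents r ∧ C'.Represents r' ∧
    ∀ χ : ℤ → ℤ, IsAssignedCharacter Δ χ → χ r = χ r'

/-- `g` is a genus of discriminant `Δ`. -/
def IsGenus {Δ : ℤ} (g : Finset (FormClass Δ)) : Prop :=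
  ∃ C : FormClass Δ, ∀ C' : FormClass Δ, C' ∈ g ↔ SameGenus C C'

/-- The set of classes `g` represents `n`, i.e. some class in it does. -/
def GenusRepresents {Δ : ℤ} (g : Finset (FormClass Δ)) (n : ℤ) : Prop :=
  ∃ C ∈ g, C.Represents n

/-- The genus `G` of discriminant `Δ p²` corresponds to the genus `g` of discriminant `Δ`. -/
def Corresponds {Δ : ℤ} {p : ℕ} (G : Finset (FormClass (Δ * (p : ℤ) ^ 2)))
    (g : Finset (FormClass Δ)) : Prop :=
  ∃ r₁ r₂ : ℤ, IsCoprime r₁ (Δ * (p : ℤ) ^ 2) ∧ IsCoprime r₂ (Δ * (p : ℤ) ^ 2) ∧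
    GenusRepresents g r₁ ∧ GenusRepresents G r₂ ∧
    ∀ χ : ℤ → ℤ, IsAssignedCharacter Δ χ → χ r₁ = χ r₂

/-- The projection operator `P_{m,r}`: keep the terms whose exponent is congruent to `r` mod `m`. -/
noncomputable def proj (m r : ℕ) (φ : PowerSeries ℚ) : PowerSeries ℚ :=
  PowerSeries.mk fun n => if n ≡ r [MOD m] then PowerSeries.coeff n φ else 0

/-- `w = 3, 2, 1` according to `Δ = -3`, `Δ = -4`, `Δ < -4`. -/
def w (Δ : ℤ) : ℚ := if Δ = -3 then 3 else if Δ = -4 then 2 else 1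

/-- `t = 2` if `16 ∣ Δ`; otherwise `t = 0` for odd `Δ` and `t = 1` for even `Δ`. -/
def t (Δ : ℤ) : ℕ := if (16 : ℤ) ∣ Δ then 2 else if Odd Δ then 0 else 1

end GenusTheta

/-!
The forms `f (p x, y)`, with `f` of discriminant `Δ` and `p ∤ f (0, 1)`, represent all classes of
discriminant `Δ p²` (`FormClass.exists_scale`): geometrically, a lattice of discriminant `Δ p²` has
a unique overlattice of index `p` and discriminant `Δ`, and conversely the sublattices of index `p`
of the lattice `ℤ²` with the form `f` correspond to the lines of `(ℤ / p)²`, the primitive ones to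
the lines on which `f` does not vanish.

Which genus the form on such a sublattice belongs to is decided by any of its values prime to `p`:
if `G` corresponds to `g` and `r` is a value of `G`, the class belongs to `G` exactly if the form it
comes from has its class in `g` and the value is *good* (`GoodValue`), that is, `r` times it is a
square modulo `p`, or for `p = 2` it is congruent to `r` modulo `2 ^ (t + 1)`
(`scale_cls_mem_iff`). This rests on the identity `4 f(u) f(v) = B² - Δ det(u, v)²`, by which the
assigned characters are constant on the values of a form, and goodness is constant on the values
prime to `p` along a line modulo `p`.

The theorem results from counting the triples of a class `F` in `G`, an embedding of its lattice
into the lattice of a class in `g`, and a vector of the sublattice with value `n`. Every `F` has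
`2 w` embeddings in all, as these form a torsor under the automorphs of the overlattice
(`PrimForm.card_isos`, `PrimForm.card_isos_self`). On the other hand the only automorphs of `F` are
`±1`, so that every good line of `f` comes from two embeddings: a vector with value `n` that is not
divisible by `p` lies in the images of two embeddings if `n` is good and of none otherwise, and a
vector divisible by `p` lies in all images (`sum_card_isos_filter`,
`sum_card_isos_mul_repCount`). The number `N` of good lines is the same for all forms in `g`: each
class in `g` contains a form with good leading coefficient `a` (`exists_cls_goodValue`), and then
completing the square in `4 a f (k, 1)` shows that `N` depends only on `Δ`
(`exists_numGoodLines_eq`). Counting pairs without a vector gives `w |G| = N |g|`, which turns `N`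
into the coefficient `w |G| / |g|`.
-/

namespace GenusTheta

local notation "SL₂ℤ" => Matrix.SpecialLinearGroup (Fin 2) ℤ

/-! ### Integral forms under `SL(2, ℤ)` -/

theorem sl_det (M : SL₂ℤ) : M 0 0 * M 1 1 - M 0 1 * M 1 0 = 1 := by
  have := M.det_coe
  rwa [Matrix.det_fin_two] at this

/-- The matrix with rows `(α, β)` and `(γ, δ)`. -/
def slMk (α β γ δ : ℤ) (h : α * δ - β * γ = 1) : SL₂ℤ :=
  ⟨!![α, β; γ, δ], by rw [Matrix.det_fin_two_of]; exact h⟩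

@[simp] theorem slMk_00 (α β γ δ : ℤ) (h : α * δ - β * γ = 1) : slMk α β γ δ h 0 0 = α := rfl
@[simp] theorem slMk_01 (α β γ δ : ℤ) (h : α * δ - β * γ = 1) : slMk α β γ δ h 0 1 = β := rfl
@[simp] theorem slMk_10 (α β γ δ : ℤ) (h : α * δ - β * γ = 1) : slMk α β γ δ h 1 0 = γ := rfl
@[simp] theorem slMk_11 (α β γ δ : ℤ) (h : α * δ - β * γ = 1) : slMk α β γ δ h 1 1 = δ := rfl

theorem sl_ext {M N : SL₂ℤ} (h00 : M 0 0 = N 0 0) (h01 : M 0 1 = N 0 1) (h10 : M 1 0 = N 1 0)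
    (h11 : M 1 1 = N 1 1) : M = N := by
  ext i j
  fin_cases i <;> fin_cases j <;> assumption

theorem sl_mul_apply (M N : SL₂ℤ) (i j : Fin 2) :
    (M * N) i j = M i 0 * N 0 j + M i 1 * N 1 j := by
  simp [Matrix.SpecialLinearGroup.coe_mul, Matrix.mul_apply, Fin.sum_univ_two]

theorem sl_inv_00 (M : SL₂ℤ) : M⁻¹ 0 0 = M 1 1 := by
  simp [Matrix.SpecialLinearGroup.coe_inv, Matrix.adjugate_fin_two]

theorem sl_inv_01 (M : SL₂ℤ) : M⁻¹ 0 1 = -M 0 1 := by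
  simp [Matrix.SpecialLinearGroup.coe_inv, Matrix.adjugate_fin_two]

theorem sl_inv_11 (M : SL₂ℤ) : M⁻¹ 1 1 = M 0 0 := by
  simp [Matrix.SpecialLinearGroup.coe_inv, Matrix.adjugate_fin_two]

theorem BQForm.eq_of_eval {f g : BQForm} (h : ∀ x y, f.eval x y = g.eval x y) : f = g := by
  have h1 := h 1 0
  have h2 := h 0 1
  have h3 := h 1 1
  simp only [BQForm.eval] at h1 h2 h3
  ext <;> linarith

theorem PrimForm.ext_form {Δ : ℤ} {f g : PrimForm Δ} (h : f.form = g.form) : f = g := by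
  cases f; cases g; simp only at h; subst h; rfl

theorem PrimForm.eq_of_eval {Δ : ℤ} {f g : PrimForm Δ}
    (h : ∀ x y, f.form.eval x y = g.form.eval x y) : f = g :=
  PrimForm.ext_form (BQForm.eq_of_eval h)

theorem PrimForm.disc_eq' {Δ : ℤ} (f : PrimForm Δ) :
    f.form.b ^ 2 - 4 * f.form.a * f.form.c = Δ := f.disc_eq

theorem PrimForm.lt_zero {Δ : ℤ} (f : PrimForm Δ) : Δ < 0 := f.disc_eq ▸ f.disc_neg

theorem PrimForm.emod_four {Δ : ℤ} (f : PrimForm Δ) : Δ % 4 = 0 ∨ Δ % 4 = 1 := by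
  have h := f.disc_eq'
  have h1 : f.form.b ^ 2 % 4 = 0 ∨ f.form.b ^ 2 % 4 = 1 := by
    rcases Int.even_or_odd f.form.b with ⟨k, hk⟩ | ⟨k, hk⟩ <;> rw [hk]
    · left; ring_nf; omega
    · right; ring_nf; omega
  have h2 : (4 * f.form.a * f.form.c) % 4 = 0 := by rw [mul_assoc]; omega
  omega

theorem PrimForm.eval_pos {Δ : ℤ} (f : PrimForm Δ) {x y : ℤ} (h : x ≠ 0 ∨ y ≠ 0) :
    0 < f.form.eval x y := by
  have h1 : 4 * f.form.a * f.form.eval x y =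
      (2 * f.form.a * x + f.form.b * y) ^ 2 + -Δ * y ^ 2 := by
    simp only [BQForm.eval]
    linear_combination -y ^ 2 * f.disc_eq'
  have h2 : 0 < (2 * f.form.a * x + f.form.b * y) ^ 2 + -Δ * y ^ 2 := by
    have := f.lt_zero
    rcases eq_or_ne y 0 with rfl | hy
    · have hx : x ≠ 0 := by simpa using h
      have ha := f.a_pos.ne'
      have : 2 * f.form.a * x ≠ 0 := by simp [ha, hx]
      simpa using sq_pos_of_ne_zero this
    · have := mul_pos (neg_pos.mpr this) (sq_pos_of_ne_zero hy)
      positivity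
  have ha := f.a_pos
  rw [← h1] at h2
  exact (mul_pos_iff_of_pos_left (by positivity)).mp h2

theorem PrimForm.isUnit_of_dvd_eval {Δ : ℤ} (f : PrimForm Δ) {d : ℤ}
    (h : ∀ x y, d ∣ f.form.eval x y) : IsUnit d := by
  have h1 : d ∣ f.form.a := by simpa [BQForm.eval] using h 1 0
  have h2 : d ∣ f.form.c := by simpa [BQForm.eval] using h 0 1
  have h3 : d ∣ f.form.a + f.form.b + f.form.c := by simpa [BQForm.eval] using h 1 1
  refine f.form.isUnit_of_dvd f.primitive d h1 ?_ h2
  have := dvd_sub (dvd_sub h3 h1) h2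
  rwa [show f.form.a + f.form.b + f.form.c - f.form.a - f.form.c = f.form.b by ring] at this

theorem sl_col_ne_zero (M : SL₂ℤ) (j : Fin 2) : M 0 j ≠ 0 ∨ M 1 j ≠ 0 := by
  by_contra! h
  have := sl_det M
  fin_cases j <;> simp_all

/-- The form `(x, y) ↦ f (α x + β y) (γ x + δ y)` for `M` with rows `(α, β)`, `(γ, δ)`; this is a
right action of `SL(2, ℤ)`. -/
def PrimForm.act {Δ : ℤ} (f : PrimForm Δ) (M : SL₂ℤ) : PrimForm Δ where
  form := ⟨f.form.eval (M 0 0) (M 1 0),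
    2 * f.form.a * M 0 0 * M 0 1 + f.form.b * (M 0 0 * M 1 1 + M 0 1 * M 1 0)
      + 2 * f.form.c * M 1 0 * M 1 1,
    f.form.eval (M 0 1) (M 1 1)⟩
  disc_eq := by
    have h := sl_det M
    refine Eq.trans ?_ f.disc_eq
    simp only [BQForm.disc, BQForm.eval]
    linear_combination (f.form.b ^ 2 - 4 * f.form.a * f.form.c) *
      (M 0 0 * M 1 1 - M 0 1 * M 1 0 + 1) * h
  disc_neg := by
    have h := sl_det M
    refine lt_of_eq_of_lt ?_ f.disc_neg
    simp only [BQForm.disc, BQForm.eval]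
    linear_combination (f.form.b ^ 2 - 4 * f.form.a * f.form.c) *
      (M 0 0 * M 1 1 - M 0 1 * M 1 0 + 1) * h
  a_pos := f.eval_pos (sl_col_ne_zero M 0)
  primitive := by
    refine BQForm.isPrimitive_of _ fun d h1 h2 h3 => f.isUnit_of_dvd_eval fun x y => ?_
    simp only at h1 h2 h3
    have h := sl_det M
    have hx : M 0 0 * (M 1 1 * x - M 0 1 * y) + M 0 1 * (M 0 0 * y - M 1 0 * x) = x := by
      linear_combination x * h
    have hy : M 1 0 * (M 1 1 * x - M 0 1 * y) + M 1 1 * (M 0 0 * y - M 1 0 * x) = y := by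
      linear_combination y * h
    have key := dvd_add (dvd_add (h1.mul_right ((M 1 1 * x - M 0 1 * y) ^ 2))
      (h2.mul_right ((M 1 1 * x - M 0 1 * y) * (M 0 0 * y - M 1 0 * x))))
      (h3.mul_right ((M 0 0 * y - M 1 0 * x) ^ 2))
    refine key.trans (dvd_of_eq (Eq.trans ?_ (congrArg₂ f.form.eval hx hy)))
    simp only [BQForm.eval]
    ring

theorem PrimForm.eval_act {Δ : ℤ} (f : PrimForm Δ) (M : SL₂ℤ) (x y : ℤ) :
    (f.act M).form.eval x y =
      f.form.eval (M 0 0 * x + M 0 1 * y) (M 1 0 * x + M 1 1 * y) := by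
  simp only [PrimForm.act, BQForm.eval]
  ring

theorem PrimForm.act_mul {Δ : ℤ} (f : PrimForm Δ) (M N : SL₂ℤ) :
    f.act (M * N) = (f.act M).act N := by
  refine PrimForm.eq_of_eval fun x y => ?_
  simp only [PrimForm.eval_act, sl_mul_apply]
  congr 1 <;> ring

theorem PrimForm.act_one {Δ : ℤ} (f : PrimForm Δ) : f.act 1 = f := by
  refine PrimForm.eq_of_eval fun x y => ?_
  simp [PrimForm.eval_act]

theorem PrimForm.act_eq_iff {Δ : ℤ} {f f' : PrimForm Δ} {M : SL₂ℤ} :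
    f.act M = f' ↔ f = f'.act M⁻¹ := by
  constructor
  · rintro rfl
    rw [← PrimForm.act_mul, mul_inv_cancel, PrimForm.act_one]
  · rintro rfl
    rw [← PrimForm.act_mul, inv_mul_cancel, PrimForm.act_one]

/-- The proper equivalence class of `f`. -/
def PrimForm.cls {Δ : ℤ} (f : PrimForm Δ) : FormClass Δ := Quotient.mk _ f

theorem PrimForm.cls_eq_iff {Δ : ℤ} {f f' : PrimForm Δ} :
    f.cls = f'.cls ↔ ∃ M : SL₂ℤ, f.act M = f' := by
  refine Quotient.eq.trans ?_
  refine exists_congr fun M => ⟨fun h => ?_, fun h x y => ?_⟩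
  · exact PrimForm.eq_of_eval fun x y => by rw [PrimForm.eval_act, h]
  · rw [← h, PrimForm.eval_act]

theorem FormClass.exists_cls {Δ : ℤ} (C : FormClass Δ) : ∃ f : PrimForm Δ, f.cls = C :=
  Quotient.exists_rep C

theorem PrimForm.cls_act {Δ : ℤ} (f : PrimForm Δ) (M : SL₂ℤ) : (f.act M).cls = f.cls :=
  (PrimForm.cls_eq_iff.mpr ⟨M, rfl⟩).symm

theorem PrimForm.coeff_theta {Δ : ℤ} (f : PrimForm Δ) (n : ℕ) :
    PowerSeries.coeff n f.cls.theta = (f.form.repCount n : ℚ) := by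
  change PowerSeries.coeff n (PowerSeries.mk fun n => (f.form.repCount n : ℚ)) = _
  rw [PowerSeries.coeff_mk]

theorem PrimForm.cls_represents {Δ : ℤ} (f : PrimForm Δ) (n : ℤ) :
    f.cls.Represents n ↔ ∃ x y, f.form.eval x y = n := by
  constructor
  · rintro ⟨f', h, x, y, hxy⟩
    obtain ⟨M, rfl⟩ := PrimForm.cls_eq_iff.mp (show f.cls = f'.cls from h.symm)
    exact ⟨_, _, (f.eval_act M x y).symm.trans hxy⟩
  · rintro ⟨x, y, h⟩
    exact ⟨f, rfl, x, y, h⟩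

/-! ### The form `f (p x, y)` -/

section Scale
variable {Δ : ℤ} {p : ℕ} [hp : Fact p.Prime]

theorem prime_int (p : ℕ) [hp : Fact p.Prime] : Prime (p : ℤ) := Nat.prime_iff_prime_int.mp hp.out

/-- The form `f (p x, y)` of discriminant `Δ p²`, the restriction of `f` to a sublattice of index
`p`. It is primitive because `p ∤ f (0, 1)`. -/
def PrimForm.scale (f : PrimForm Δ) (h : ¬ (p : ℤ) ∣ f.form.c) : PrimForm (Δ * (p : ℤ) ^ 2) where
  form := ⟨f.form.a * p ^ 2, f.form.b * p, f.form.c⟩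
  disc_eq := by
    simp only [BQForm.disc]
    linear_combination (p : ℤ) ^ 2 * f.disc_eq'
  disc_neg := by
    have h1 := f.disc_neg
    have h2 : (0 : ℤ) < (p : ℤ) ^ 2 := by have := hp.out.pos; positivity
    have := mul_neg_of_neg_of_pos h1 h2
    refine lt_of_eq_of_lt ?_ this
    simp only [BQForm.disc]; ring
  a_pos := by
    have h1 := f.a_pos
    have := hp.out.pos
    simp only
    positivity
  primitive := by
    refine BQForm.isPrimitive_of _ fun d h1 h2 h3 => ?_
    simp only at h1 h2 h3
    have hd : IsCoprime d (p : ℤ) := by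
      refine ((prime_int p).coprime_iff_not_dvd.mpr fun hpd => h (hpd.trans h3)).symm
    exact f.form.isUnit_of_dvd f.primitive d ((hd.pow_right).dvd_of_dvd_mul_right h1)
      (hd.dvd_of_dvd_mul_right h2) h3

theorem PrimForm.eval_scale (f : PrimForm Δ) (h : ¬ (p : ℤ) ∣ f.form.c) (x y : ℤ) :
    (f.scale h).form.eval x y = f.form.eval (p * x) y := by
  simp only [PrimForm.scale, BQForm.eval]; ring

theorem PrimForm.eq_of_eval_scale {f f' : PrimForm Δ}
    (h : ∀ x y, f.form.eval (p * x) y = f'.form.eval (p * x) y) : f = f' := by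
  have hp0 : (p : ℤ) ≠ 0 := (prime_int p).ne_zero
  have h1 := h 1 0
  have h2 := h 0 1
  have h3 := h 1 1
  simp only [BQForm.eval, mul_one, mul_zero, one_pow, zero_pow two_ne_zero, add_zero,
    zero_add] at h1 h2 h3
  have ha : f.form.a = f'.form.a := mul_right_cancel₀ (pow_ne_zero 2 hp0) h1
  have hb : f.form.b = f'.form.b := mul_right_cancel₀ hp0 (by linarith)
  exact PrimForm.ext_form (BQForm.ext ha hb h2)

/-- An equivalence of the scaled forms comes from one of the original forms: the lattice of index
`p` on which `f (p x, y)` lives determines its overlattice. -/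
theorem PrimForm.exists_act_of_scale_act {f f' : PrimForm Δ} {h : ¬ (p : ℤ) ∣ f.form.c}
    {h' : ¬ (p : ℤ) ∣ f'.form.c} {M : SL₂ℤ} (hM : (f.scale h).act M = f'.scale h') :
    ∃ N : SL₂ℤ, f.act N = f' ∧ (p : ℤ) ∣ N 0 1 := by
  have hev : ∀ x y, f.form.eval (p * (M 0 0 * x + M 0 1 * y)) (M 1 0 * x + M 1 1 * y) =
      f'.form.eval (p * x) y := fun x y => by
    rw [← PrimForm.eval_scale f h, ← PrimForm.eval_act, hM, PrimForm.eval_scale]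
  have h1 : (p : ℤ) ∣ M 1 0 := by
    have e := hev 1 0
    simp only [BQForm.eval, mul_one, mul_zero, add_zero] at e
    have : (p : ℤ) ∣ f.form.c * M 1 0 ^ 2 :=
      ⟨f'.form.a * p - f.form.a * p * M 0 0 ^ 2 - f.form.b * M 0 0 * M 1 0, by
        linear_combination e⟩
    exact (prime_int p).dvd_of_dvd_pow (((prime_int p).dvd_or_dvd this).resolve_left h)
  obtain ⟨k, hk⟩ := h1
  have hdet := sl_det M
  refine ⟨slMk (M 0 0) (p * M 0 1) k (M 1 1) (by rw [hk] at hdet; linear_combination hdet), ?_,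
    by simp⟩
  refine PrimForm.eq_of_eval_scale (p := p) fun x y => ?_
  rw [← hev x y, PrimForm.eval_act]
  simp only [slMk_00, slMk_01, slMk_10, slMk_11, hk]
  congr 1 <;> ring

theorem PrimForm.scale_act {f f' : PrimForm Δ} (h : ¬ (p : ℤ) ∣ f.form.c)
    (h' : ¬ (p : ℤ) ∣ f'.form.c) {N : SL₂ℤ} (hN : f.act N = f') (hN' : (p : ℤ) ∣ N 0 1) :
    ∃ M : SL₂ℤ, (f.scale h).act M = f'.scale h' ∧ M 0 0 = N 0 0 ∧ N 0 1 = p * M 0 1 ∧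
      M 1 0 = p * N 1 0 ∧ M 1 1 = N 1 1 := by
  obtain ⟨k, hk⟩ := hN'
  have hdet := sl_det N
  refine ⟨slMk (N 0 0) k (p * N 1 0) (N 1 1) (by rw [hk] at hdet; linear_combination hdet), ?_,
    rfl, hk, rfl, rfl⟩
  refine PrimForm.eq_of_eval fun x y => ?_
  rw [PrimForm.eval_act, PrimForm.eval_scale, PrimForm.eval_scale, ← hN, PrimForm.eval_act]
  simp only [slMk_00, slMk_01, slMk_10, slMk_11, hk]
  congr 1 <;> ring

/-- If `p` divides the leading coefficient of a form of discriminant `Δ p²`, the form is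
`f (p x, y)` for some `f`. -/
theorem PrimForm.exists_scale_of_dvd (hΔ : Δ % 4 = 0 ∨ Δ % 4 = 1) (F : PrimForm (Δ * (p : ℤ) ^ 2))
    (ha : (p : ℤ) ∣ F.form.a) :
    ∃ (f : PrimForm Δ) (h : ¬ (p : ℤ) ∣ f.form.c), f.scale h = F := by
  have hpr := prime_int p
  have hp0 : (p : ℤ) ≠ 0 := hpr.ne_zero
  have hd := F.disc_eq'
  have hb : (p : ℤ) ∣ F.form.b := by
    obtain ⟨k, hk⟩ := ha
    refine hpr.dvd_of_dvd_pow (n := 2) ⟨Δ * p + 4 * k * F.form.c, ?_⟩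
    rw [hk] at hd
    linear_combination hd
  have hc : ¬ (p : ℤ) ∣ F.form.c := fun hc =>
    hpr.not_isUnit (F.form.isUnit_of_dvd F.primitive _ ha hb hc)
  obtain ⟨b, hb⟩ := hb
  have h4 : 4 * (F.form.a * F.form.c) = (p : ℤ) ^ 2 * (b ^ 2 - Δ) := by
    rw [hb] at hd; linear_combination -hd
  have hac : (p : ℤ) ^ 2 ∣ F.form.a * F.form.c := by
    rcases hp.out.eq_two_or_odd' with rfl | hodd
    · -- modulo `4`, both `b ^ 2` and `Δ` are `0` or `1`, and they have the same parity
      have h5 : F.form.a * F.form.c = b ^ 2 - Δ := by push_cast at h4; linarith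
      have h6 : (b ^ 2 - Δ) % 2 = 0 := by
        rw [← h5]; obtain ⟨k, hk⟩ := ha; rw [hk]; push_cast; rw [mul_assoc]; omega
      rw [h5]
      push_cast
      rcases Int.even_or_odd b with ⟨k, hk⟩ | ⟨k, hk⟩ <;> rw [hk] at h6 ⊢ <;> ring_nf at h6 ⊢ <;>
        omega
    · have hcop : IsCoprime ((p : ℤ) ^ 2) 4 := by
        have h2 : IsCoprime (p : ℤ) 2 := by
          exact_mod_cast (Nat.isCoprime_iff_coprime.mpr
            (Nat.coprime_two_right.mpr hodd))
        have := h2.pow (m := 2) (n := 2)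
        norm_num at this
        exact this
      exact hcop.dvd_of_dvd_mul_left ⟨_, h4⟩
  obtain ⟨a, ha'⟩ : (p : ℤ) ^ 2 ∣ F.form.a :=
    ((hpr.coprime_iff_not_dvd.mpr hc).pow_left).dvd_of_dvd_mul_right hac
  have hdisc : b ^ 2 - 4 * a * F.form.c = Δ := by
    rw [ha'] at h4
    have : (p : ℤ) ^ 2 * (b ^ 2 - 4 * a * F.form.c) = p ^ 2 * Δ := by linear_combination -h4
    exact mul_left_cancel₀ (pow_ne_zero 2 hp0) this
  have hp2 : (0 : ℤ) < (p : ℤ) ^ 2 := by positivity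
  refine ⟨⟨⟨a, b, F.form.c⟩, hdisc, ?_, ?_, ?_⟩, hc, ?_⟩
  · have : BQForm.disc ⟨a, b, F.form.c⟩ = Δ := hdisc
    rw [this]
    have := F.lt_zero
    exact (pos_iff_neg_of_mul_neg (by linarith)).mp hp2
  · have := F.a_pos
    rw [ha'] at this
    exact (mul_pos_iff_of_pos_left hp2).mp this
  · refine BQForm.isPrimitive_of _ fun d h1 h2 h3 => ?_
    exact F.form.isUnit_of_dvd F.primitive d (ha' ▸ h1.mul_left _) (hb ▸ h2.mul_left _) h3
  · refine PrimForm.ext_form (BQForm.ext ?_ ?_ rfl)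
    · simp only [PrimForm.scale, ha']; ring
    · simp only [PrimForm.scale, hb]; ring

/-- Every class of discriminant `Δ p²` contains a form `f (p x, y)`. -/
theorem FormClass.exists_scale (hΔ : Δ % 4 = 0 ∨ Δ % 4 = 1) (C : FormClass (Δ * (p : ℤ) ^ 2)) :
    ∃ (f : PrimForm Δ) (h : ¬ (p : ℤ) ∣ f.form.c), (f.scale h).cls = C := by
  obtain ⟨F, rfl⟩ := C.exists_cls
  have hpr := prime_int p
  by_cases ha : (p : ℤ) ∣ F.form.a
  · obtain ⟨f, h, hf⟩ := F.exists_scale_of_dvd hΔ ha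
    exact ⟨f, h, by rw [hf]⟩
  -- modulo `p` the form is a multiple of the square of a linear form, so it has a zero `(k : 1)`
  obtain ⟨k, hk⟩ : ∃ k : ℤ, (p : ℤ) ∣ F.form.a * k ^ 2 + F.form.b * k + F.form.c := by
    have hd := F.disc_eq'
    rcases hp.out.eq_two_or_odd' with rfl | hodd
    · refine ⟨F.form.c, ?_⟩
      have hb : (2 : ℤ) ∣ F.form.b := by
        refine Int.prime_two.dvd_of_dvd_pow (n := 2) ⟨2 * Δ + 2 * F.form.a * F.form.c, ?_⟩
        push_cast at hd
        linear_combination hd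
      obtain ⟨b, hb⟩ := hb
      push_cast at ha ⊢
      rcases Int.even_or_odd F.form.a with ⟨a, h1⟩ | ⟨a, h1⟩
      · exact absurd ⟨a, by omega⟩ ha
      · rcases Int.even_or_odd F.form.c with ⟨c, h2⟩ | ⟨c, h2⟩ <;> rw [hb, h1, h2] <;> ring_nf <;>
          omega
    · have h2 : IsCoprime (2 : ℤ) p := by
        exact_mod_cast (Nat.isCoprime_iff_coprime.mpr
          (Nat.coprime_two_left.mpr hodd))
      have hcop : IsCoprime (2 * F.form.a) (p : ℤ) :=
        h2.mul_left (hpr.coprime_iff_not_dvd.mpr ha).symm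
      obtain ⟨u, v, huv⟩ := hcop
      refine ⟨-F.form.b * u, ?_⟩
      have hcop4 : IsCoprime (p : ℤ) (2 * (2 * F.form.a)) := (h2.mul_left ⟨u, v, huv⟩).symm
      refine hcop4.dvd_of_dvd_mul_left ⟨p * (F.form.b ^ 2 * v ^ 2 - Δ), ?_⟩
      have h3 : 2 * F.form.a * u = 1 - v * p := by linear_combination huv
      have : 2 * (2 * F.form.a) * (F.form.a * (-F.form.b * u) ^ 2 + F.form.b * (-F.form.b * u) +
          F.form.c) = F.form.b ^ 2 * (1 - 2 * F.form.a * u) ^ 2 -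
          (F.form.b ^ 2 - 4 * F.form.a * F.form.c) := by ring
      rw [this, h3, hd]
      ring
  obtain ⟨f, h, hf⟩ := ((F.shift k).swap).exists_scale_of_dvd hΔ hk
  refine ⟨f, h, ?_⟩
  rw [hf]
  exact (Quotient.sound ((F.equivalent_shift k).trans (F.shift k).equivalent_swap)).symm

end Scale

/-! ### Assigned characters -/

theorem BQForm.four_mul_eval_mul_eval (f : BQForm) (x y x' y' : ℤ) :
    4 * (f.eval x y * f.eval x' y') =
      (2 * f.a * x * x' + f.b * (x * y' + y * x') + 2 * f.c * y * y') ^ 2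
        - f.disc * (x * y' - y * x') ^ 2 := by
  simp only [BQForm.eval, BQForm.disc]; ring

/-- The product of two values of a form of discriminant `-4 n` is a value of `x² + n y²`. -/
theorem BQForm.exists_eval_mul_eval (f : BQForm) {n : ℤ} (hn : f.disc = -4 * n) (x y x' y' : ℤ) :
    ∃ B, f.eval x y * f.eval x' y' = B ^ 2 + n * (x * y' - y * x') ^ 2 := by
  have h := f.four_mul_eval_mul_eval x y x' y'
  rw [hn] at h
  have h2 : (2 : ℤ) ∣ 2 * f.a * x * x' + f.b * (x * y' + y * x') + 2 * f.c * y * y' := by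
    refine Int.prime_two.dvd_of_dvd_pow (n := 2)
      ⟨2 * (f.eval x y * f.eval x' y' - n * (x * y' - y * x') ^ 2), ?_⟩
    linear_combination -h
  obtain ⟨B, hB⟩ := h2
  refine ⟨B, ?_⟩
  rw [hB] at h
  linarith

theorem legendreSym_eq_of_dvd {l : ℕ} [Fact l.Prime] (hl : l ≠ 2) {m m' B : ℤ}
    (hm : ¬ (l : ℤ) ∣ m) (hm' : ¬ (l : ℤ) ∣ m') (h : (l : ℤ) ∣ 4 * (m * m') - B ^ 2) :
    legendreSym l m = legendreSym l m' := by
  have h0 : (m : ZMod l) ≠ 0 := fun h => hm ((ZMod.intCast_zmod_eq_zero_iff_dvd _ _).mp h)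
  have h0' : (m' : ZMod l) ≠ 0 := fun h => hm' ((ZMod.intCast_zmod_eq_zero_iff_dvd _ _).mp h)
  have h2 : ((2 : ℤ) : ZMod l) ≠ 0 := fun h => by
    rw [ZMod.intCast_zmod_eq_zero_iff_dvd] at h
    have := (Nat.prime_dvd_prime_iff_eq Fact.out Nat.prime_two).mp (by exact_mod_cast h)
    exact hl this
  have e : ((4 * (m * m') : ℤ) : ZMod l) = ((B ^ 2 : ℤ) : ZMod l) := by
    rw [← sub_eq_zero, ← Int.cast_sub, ZMod.intCast_zmod_eq_zero_iff_dvd]; exact h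
  have hB : (B : ZMod l) ≠ 0 := fun hB => by
    rw [Int.cast_pow, hB, zero_pow two_ne_zero] at e
    rw [show (4 : ℤ) * (m * m') = 2 * (2 * (m * m')) by ring] at e
    push_cast at e h2
    simp [h0, h0', h2] at e
  have key : legendreSym l (4 * (m * m')) = legendreSym l (B ^ 2) := by
    simp only [legendreSym]; rw [e]
  rw [legendreSym.sq_one' l hB, show (4 : ℤ) * (m * m') = 2 ^ 2 * (m * m') by ring,
    legendreSym.mul, legendreSym.sq_one' l h2, legendreSym.mul, one_mul] at key
  rcases legendreSym.eq_one_or_neg_one l h0 with h | h <;>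
    rcases legendreSym.eq_one_or_neg_one l h0' with h' | h' <;> rw [h, h'] at key ⊢ <;>
    norm_num at key

theorem sq_emod_eight (x : ℤ) : x ^ 2 % 8 = 0 ∧ x % 4 = 0 ∨ x ^ 2 % 8 = 4 ∧ x % 4 = 2 ∨
    x ^ 2 % 8 = 1 ∧ x % 2 = 1 := by
  have : x % 8 = 0 ∨ x % 8 = 1 ∨ x % 8 = 2 ∨ x % 8 = 3 ∨ x % 8 = 4 ∨ x % 8 = 5 ∨ x % 8 = 6 ∨
    x % 8 = 7 := by omega
  have e : x ^ 2 % 8 = (x % 8) * (x % 8) % 8 := by rw [sq, Int.mul_emod]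
  rcases this with h | h | h | h | h | h | h | h <;> rw [h] at e <;> omega

theorem emod_eight_of_odd {m : ℤ} (h : m % 2 = 1) :
    m % 8 = 1 ∨ m % 8 = 3 ∨ m % 8 = 5 ∨ m % 8 = 7 := by omega

theorem chi4_eq_iff {m m' : ℤ} (h : m % 2 = 1) (h' : m' % 2 = 1) :
    ZMod.χ₄ m = ZMod.χ₄ m' ↔ m * m' % 4 = 1 := by
  have e : m * m' % 8 = (m % 8) * (m' % 8) % 8 := Int.mul_emod _ _ _
  rw [ZMod.χ₄_int_eq_if_mod_four, ZMod.χ₄_int_eq_if_mod_four, if_neg (Int.emod_two_ne_zero.mpr h),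
    if_neg (Int.emod_two_ne_zero.mpr h')]
  rcases emod_eight_of_odd h with h1 | h1 | h1 | h1 <;>
    rcases emod_eight_of_odd h' with h2 | h2 | h2 | h2 <;> rw [h1, h2] at e <;>
    split_ifs <;> constructor <;> intro <;> first | contradiction | omega

theorem chi8_eq_iff {m m' : ℤ} (h : m % 2 = 1) (h' : m' % 2 = 1) :
    ZMod.χ₈ m = ZMod.χ₈ m' ↔ m * m' % 8 = 1 ∨ m * m' % 8 = 7 := by
  have e : m * m' % 8 = (m % 8) * (m' % 8) % 8 := Int.mul_emod _ _ _
  rw [ZMod.χ₈_int_eq_if_mod_eight, ZMod.χ₈_int_eq_if_mod_eight,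
    if_neg (Int.emod_two_ne_zero.mpr h), if_neg (Int.emod_two_ne_zero.mpr h')]
  rcases emod_eight_of_odd h with h1 | h1 | h1 | h1 <;>
    rcases emod_eight_of_odd h' with h2 | h2 | h2 | h2 <;> rw [e, h1, h2] <;> decide

theorem chi8'_eq_iff {m m' : ℤ} (h : m % 2 = 1) (h' : m' % 2 = 1) :
    ZMod.χ₈' m = ZMod.χ₈' m' ↔ m * m' % 8 = 1 ∨ m * m' % 8 = 3 := by
  have e : m * m' % 8 = (m % 8) * (m' % 8) % 8 := Int.mul_emod _ _ _
  rw [ZMod.χ₈'_int_eq_if_mod_eight, ZMod.χ₈'_int_eq_if_mod_eight,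
    if_neg (Int.emod_two_ne_zero.mpr h), if_neg (Int.emod_two_ne_zero.mpr h')]
  rcases emod_eight_of_odd h with h1 | h1 | h1 | h1 <;>
    rcases emod_eight_of_odd h' with h2 | h2 | h2 | h2 <;> rw [e, h1, h2] <;> decide

/-- The integers `m` and `m'` agree under all assigned characters of `Δ`. -/
def CharEq (Δ m m' : ℤ) : Prop := ∀ χ : ℤ → ℤ, IsAssignedCharacter Δ χ → χ m = χ m'

theorem CharEq.symm {Δ m m' : ℤ} (h : CharEq Δ m m') : CharEq Δ m' m :=
  fun χ hχ => (h χ hχ).symm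

theorem CharEq.trans {Δ m m' m'' : ℤ} (h : CharEq Δ m m') (h' : CharEq Δ m' m'') :
    CharEq Δ m m'' := fun χ hχ => (h χ hχ).trans (h' χ hχ)

theorem odd_of_isCoprime {m D : ℤ} (h : IsCoprime m D) (hD : (2 : ℤ) ∣ D) : m % 2 = 1 := by
  rcases Int.emod_two_eq_zero_or_one m with h0 | h0
  · have := h.isUnit_of_dvd' (Int.dvd_of_emod_eq_zero h0) hD
    rw [Int.isUnit_iff] at this
    omega
  · exact h0

theorem not_dvd_of_isCoprime {l : ℕ} [hl : Fact l.Prime] {m D : ℤ} (h : IsCoprime m D)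
    (hD : (l : ℤ) ∣ D) : ¬ (l : ℤ) ∣ m := fun hm =>
  (prime_int l).not_isUnit (h.isUnit_of_dvd' hm hD)

/-- The assigned characters at the odd primes and at `2`, the latter in terms of the residue of
`m m'` modulo `8`. -/
theorem charEq_iff {Δ m m' : ℤ} (h : IsCoprime m Δ) (h' : IsCoprime m' Δ) :
    CharEq Δ m m' ↔
      (∀ (l : ℕ) [Fact l.Prime], l ≠ 2 → (l : ℤ) ∣ Δ → legendreSym l m = legendreSym l m') ∧
      ∀ n, Δ = -4 * n →
        (n % 4 = 1 ∨ n % 8 = 4 ∨ n % 8 = 0 → m * m' % 4 = 1) ∧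
        (n % 8 = 6 ∨ n % 8 = 0 → m * m' % 8 = 1 ∨ m * m' % 8 = 7) ∧
        (n % 8 = 2 → m * m' % 8 = 1 ∨ m * m' % 8 = 3) := by
  have odd : ∀ n, Δ = -4 * n → m % 2 = 1 ∧ m' % 2 = 1 := fun n hn =>
    have h2 : (2 : ℤ) ∣ Δ := ⟨-2 * n, by linarith⟩
    ⟨odd_of_isCoprime h h2, odd_of_isCoprime h' h2⟩
  constructor
  · intro H
    refine ⟨fun l _ hl hd => H _ (.legendre l hl hd), fun n hn => ?_⟩
    obtain ⟨o, o'⟩ := odd n hn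
    exact ⟨fun hc => (chi4_eq_iff o o').mp (H _ (.neg_one n hn hc)),
      fun hc => (chi8_eq_iff o o').mp (H _ (.two n hn hc)),
      fun hc => (chi8'_eq_iff o o').mp (H _ (.neg_two n hn hc))⟩
  · rintro ⟨H1, H2⟩ χ (⟨l, hl, hd⟩ | ⟨n, hn, hc⟩ | ⟨n, hn, hc⟩ | ⟨n, hn, hc⟩)
    · exact H1 l hl hd
    · exact (chi4_eq_iff (odd n hn).1 (odd n hn).2).mpr ((H2 n hn).1 hc)
    · exact (chi8_eq_iff (odd n hn).1 (odd n hn).2).mpr ((H2 n hn).2.1 hc)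
    · exact (chi8'_eq_iff (odd n hn).1 (odd n hn).2).mpr ((H2 n hn).2.2 hc)

theorem mul_emod_two {m m' : ℤ} (h : m % 2 = 1) (h' : m' % 2 = 1) : m * m' % 2 = 1 := by
  rw [Int.mul_emod, h, h']; norm_num

/-- The assigned characters are constant on the values of a form prime to the discriminant. -/
theorem PrimForm.charEq {Δ : ℤ} (f : PrimForm Δ) {x y x' y' : ℤ}
    (h : IsCoprime (f.form.eval x y) Δ) (h' : IsCoprime (f.form.eval x' y') Δ) :
    CharEq Δ (f.form.eval x y) (f.form.eval x' y') := by
  rw [charEq_iff h h']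
  constructor
  · intro l _ hl hd
    refine legendreSym_eq_of_dvd hl (not_dvd_of_isCoprime h hd) (not_dvd_of_isCoprime h' hd)
      (B := 2 * f.form.a * x * x' + f.form.b * (x * y' + y * x') + 2 * f.form.c * y * y') ?_
    rw [f.form.four_mul_eval_mul_eval, f.disc_eq, sub_sub_cancel_left, dvd_neg]
    exact hd.mul_right _
  · intro n hn
    obtain ⟨B, hB⟩ := f.form.exists_eval_mul_eval (f.disc_eq.trans hn) x y x' y'
    have h2 : (2 : ℤ) ∣ Δ := ⟨-2 * n, by linarith⟩
    have ho := mul_emod_two (odd_of_isCoprime h h2) (odd_of_isCoprime h' h2)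
    rw [hB] at ho ⊢
    set D := x * y' - y * x'
    have e : n * D ^ 2 % 8 = (n % 8) * (D ^ 2 % 8) % 8 := Int.mul_emod _ _ _
    have hn8 : n % 8 = 0 ∨ n % 8 = 1 ∨ n % 8 = 2 ∨ n % 8 = 3 ∨ n % 8 = 4 ∨ n % 8 = 5 ∨ n % 8 = 6 ∨
      n % 8 = 7 := by omega
    rcases sq_emod_eight B with b | b | b <;> rcases sq_emod_eight D with d | d | d <;>
      rcases hn8 with hn8 | hn8 | hn8 | hn8 | hn8 | hn8 | hn8 | hn8 <;>
      rw [hn8, d.1] at e <;> omega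

/-! ### Good values -/

/-- The condition that separates the values of the forms `f` of a genus of discriminant `Δ` which
are taken on by a given genus of discriminant `Δ p²`; `r` is one such value. -/
def GoodValue (Δ : ℤ) (p : ℕ) [Fact p.Prime] (r m : ℤ) : Prop :=
  if p = 2 then m ≡ r [ZMOD 2 ^ (t Δ + 1)] else legendreSym p (r * m) = 1

section Good
variable {Δ : ℤ} {p : ℕ} [hp : Fact p.Prime] {r m m' : ℤ}

theorem goodValue_two_iff (h : m % 2 = 1) (hr : r % 2 = 1) :
    GoodValue Δ 2 r m ↔ (Δ % 2 = 0 → m * r % 4 = 1) ∧ (Δ % 16 = 0 → m * r % 8 = 1) := by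
  have e : m * r % 8 = (m % 8) * (r % 8) % 8 := Int.mul_emod _ _ _
  rw [GoodValue, if_pos rfl, t, Int.ModEq]
  rcases emod_eight_of_odd h with h1 | h1 | h1 | h1 <;>
    rcases emod_eight_of_odd hr with h2 | h2 | h2 | h2 <;> rw [h1, h2] at e <;>
    split_ifs with c1 c2 <;> (try rw [Int.odd_iff] at c2) <;> norm_num <;> omega

theorem goodValue_odd_iff (h2 : p ≠ 2) (h : ¬ (p : ℤ) ∣ m) (hr : ¬ (p : ℤ) ∣ r) :
    GoodValue Δ p r m ↔ legendreSym p m = legendreSym p r := by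
  have h0 : (m : ZMod p) ≠ 0 := fun e => h ((ZMod.intCast_zmod_eq_zero_iff_dvd _ _).mp e)
  have h0' : (r : ZMod p) ≠ 0 := fun e => hr ((ZMod.intCast_zmod_eq_zero_iff_dvd _ _).mp e)
  rw [GoodValue, if_neg h2, legendreSym.mul]
  rcases legendreSym.eq_one_or_neg_one p h0 with h | h <;>
    rcases legendreSym.eq_one_or_neg_one p h0' with h' | h' <;> rw [h, h'] <;> norm_num

theorem not_dvd_of_goodValue (hr : ¬ (p : ℤ) ∣ r) (h : GoodValue Δ p r m) : ¬ (p : ℤ) ∣ m := by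
  intro hm
  by_cases h2 : p = 2
  · subst h2
    rw [GoodValue, if_pos rfl] at h
    have h3 : (2 : ℤ) ∣ m - r := (dvd_pow_self 2 (Nat.succ_ne_zero _)).trans h.symm.dvd
    push_cast at hm hr
    exact hr ((dvd_sub_right hm).mp h3)
  · rw [GoodValue, if_neg h2] at h
    have : ((r * m : ℤ) : ZMod p) = 0 := (ZMod.intCast_zmod_eq_zero_iff_dvd _ _).mpr (hm.mul_left _)
    rw [(legendreSym.eq_zero_iff p _).mpr this] at h
    norm_num at h

theorem emod_two_of_not_dvd (h : ¬ ((2 : ℕ) : ℤ) ∣ m) : m % 2 = 1 := by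
  push_cast at h; omega

/-- On two vectors that are proportional modulo `p`, the values of a form are both good or both
bad. -/
theorem PrimForm.goodValue_iff (f : PrimForm Δ) (hr : ¬ (p : ℤ) ∣ r) {x y x' y' : ℤ}
    (h : ¬ (p : ℤ) ∣ f.form.eval x y) (h' : ¬ (p : ℤ) ∣ f.form.eval x' y')
    (hd : (p : ℤ) ∣ x * y' - y * x') :
    GoodValue Δ p r (f.form.eval x y) ↔ GoodValue Δ p r (f.form.eval x' y') := by
  by_cases h2 : p = 2
  · subst h2
    have o := emod_two_of_not_dvd h
    have o' := emod_two_of_not_dvd h'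
    have o'' := emod_two_of_not_dvd hr
    rw [goodValue_two_iff o o'', goodValue_two_iff o' o'']
    by_cases hΔ : Δ % 2 = 0
    · have : Δ % 4 = 0 := by have := f.emod_four; omega
      obtain ⟨n, hn⟩ : ∃ n, Δ = -4 * n := ⟨-(Δ / 4), by omega⟩
      obtain ⟨B, hB⟩ := f.form.exists_eval_mul_eval (f.disc_eq.trans hn) x y x' y'
      have ho := mul_emod_two o o'
      obtain ⟨d, hd⟩ := hd
      rw [hd] at hB
      push_cast at hB
      rw [hB] at ho
      have e1 : n * (2 * d) ^ 2 = 4 * (n * d ^ 2) := by ring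
      have e2 : n * d ^ 2 % 4 = (n % 4) * (d ^ 2 % 4) % 4 := Int.mul_emod _ _ _
      have key : (f.form.eval x y * f.form.eval x' y') % 4 = 1 ∧
          (Δ % 16 = 0 → (f.form.eval x y * f.form.eval x' y') % 8 = 1) := by
        rw [hB, e1]
        rcases sq_emod_eight B with b | b | b <;> [omega; omega; skip]
        refine ⟨by omega, fun h16 => ?_⟩
        have : n % 4 = 0 := by omega
        rw [this, zero_mul] at e2
        omega
      have e3 := Int.mul_emod (f.form.eval x y) (f.form.eval x' y') 8
      have key4 : f.form.eval x y % 4 = f.form.eval x' y' % 4 := by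
        rcases emod_eight_of_odd o with h1 | h1 | h1 | h1 <;>
          rcases emod_eight_of_odd o' with h2 | h2 | h2 | h2 <;> rw [h1, h2] at e3 <;> omega
      have key8 : Δ % 16 = 0 → f.form.eval x y % 8 = f.form.eval x' y' % 8 := fun h16 => by
        have := key.2 h16
        rcases emod_eight_of_odd o with h1 | h1 | h1 | h1 <;>
          rcases emod_eight_of_odd o' with h2 | h2 | h2 | h2 <;> rw [h1, h2] at e3 <;> omega
      refine and_congr ?_ (forall_congr' fun h16 => ?_)
      · rw [Int.mul_emod, key4, ← Int.mul_emod]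
      · rw [Int.mul_emod, key8 h16, ← Int.mul_emod]
    · have : Δ % 16 ≠ 0 := by omega
      simp [hΔ, this]
  · rw [goodValue_odd_iff h2 h hr, goodValue_odd_iff h2 h' hr]
    rw [legendreSym_eq_of_dvd h2 h h'
      (B := 2 * f.form.a * x * x' + f.form.b * (x * y' + y * x') + 2 * f.form.c * y * y')]
    rw [f.form.four_mul_eval_mul_eval, sub_sub_cancel_left, dvd_neg]
    exact (hd.pow two_ne_zero).mul_left _

theorem sq_prime_emod_eight (h2 : p ≠ 2) : (p : ℤ) ^ 2 % 8 = 1 := by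
  have : (p : ℤ) % 2 = 1 := by
    have := hp.out.eq_two_or_odd
    omega
  rcases sq_emod_eight p with h | h | h <;> omega

/-- The assigned characters of `Δ p²` are those of `Δ` together with the ones that detect good
values. -/
theorem charEq_mul_sq_iff (hΔ : Δ % 4 = 0 ∨ Δ % 4 = 1) (h : IsCoprime m (Δ * (p : ℤ) ^ 2))
    (hr : IsCoprime r (Δ * (p : ℤ) ^ 2)) :
    CharEq (Δ * (p : ℤ) ^ 2) m r ↔ CharEq Δ m r ∧ GoodValue Δ p r m := by
  have hpd : (p : ℤ) ∣ Δ * (p : ℤ) ^ 2 := (dvd_pow_self _ two_ne_zero).mul_left _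
  have hpm := not_dvd_of_isCoprime h hpd
  have hpr := not_dvd_of_isCoprime hr hpd
  rw [charEq_iff h hr, charEq_iff h.of_mul_right_left hr.of_mul_right_left]
  by_cases h2 : p = 2
  · subst h2
    have o := emod_two_of_not_dvd hpm
    have o' := emod_two_of_not_dvd hpr
    rw [goodValue_two_iff o o']
    have hl : (∀ (l : ℕ) [Fact l.Prime], l ≠ 2 → (l : ℤ) ∣ Δ * ((2 : ℕ) : ℤ) ^ 2 →
        legendreSym l m = legendreSym l r) ↔ (∀ (l : ℕ) [Fact l.Prime], l ≠ 2 → (l : ℤ) ∣ Δ →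
        legendreSym l m = legendreSym l r) := by
      refine ⟨fun H l _ hl hd => H l hl (hd.mul_right _), fun H l _ hl hd => H l hl ?_⟩
      refine ((prime_int l).dvd_or_dvd hd).resolve_right fun hd => hl ?_
      exact (Nat.prime_dvd_prime_iff_eq Fact.out Nat.prime_two).mp
        (by exact_mod_cast (prime_int l).dvd_of_dvd_pow hd)
    rw [hl, and_assoc]
    refine and_congr_right fun _ => ?_
    have ho := mul_emod_two o o'
    set q := m * r
    constructor
    · intro H
      have H := H (-Δ) (by push_cast; ring)
      exact ⟨fun n hn => by omega, by omega, by omega⟩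
    · rintro ⟨H, H4, H8⟩ n hn
      push_cast at hn
      by_cases h4 : Δ % 4 = 0
      · have := H (-(Δ / 4)) (by omega)
        omega
      · omega
  · rw [goodValue_odd_iff h2 hpm hpr]
    have h8 := sq_prime_emod_eight (p := p) h2
    have hn : ∀ n, Δ * (p : ℤ) ^ 2 = -4 * n → ∃ k, Δ = -4 * k ∧ k % 8 = n % 8 := by
      intro n hn
      have e := Int.mul_emod Δ ((p : ℤ) ^ 2) 4
      have h4 : (p : ℤ) ^ 2 % 4 = 1 := by omega
      rw [hn, h4] at e
      obtain ⟨k, hk⟩ : ∃ k, Δ = -4 * k := ⟨-(Δ / 4), by omega⟩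
      refine ⟨k, hk, ?_⟩
      have : n = k * (p : ℤ) ^ 2 := by rw [hk] at hn; linarith
      rw [this, Int.mul_emod, h8]; omega
    constructor
    · rintro ⟨H1, H2⟩
      refine ⟨⟨fun l _ hl hd => H1 l hl (hd.mul_right _), fun n hΔn => ?_⟩, H1 p h2 hpd⟩
      obtain ⟨k, hk, hk'⟩ := hn (n * (p : ℤ) ^ 2) (by rw [hΔn]; ring)
      have := H2 (n * (p : ℤ) ^ 2) (by rw [hΔn]; ring)
      have : k = n := by omega
      subst this
      rwa [← hk', show k * (p : ℤ) ^ 2 % 4 = k % 4 by omega] at this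
    · rintro ⟨⟨H1, H2⟩, H3⟩
      refine ⟨fun l _ hl hd => ?_, fun n hΔn => ?_⟩
      · rcases (prime_int l).dvd_or_dvd hd with hd | hd
        · exact H1 l hl hd
        · have := (Nat.prime_dvd_prime_iff_eq Fact.out hp.out).mp
            (by exact_mod_cast (prime_int l).dvd_of_dvd_pow hd)
          subst this
          exact H3
      · obtain ⟨k, hk, hk'⟩ := hn n hΔn
        have := H2 k hk
        rwa [hk', show k % 4 = n % 4 by omega] at this

end Good

/-! ### Represented integers prime to a given one -/

/-- A primitive form takes a value prime to any finite set of primes. -/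
theorem PrimForm.exists_eval_not_dvd {Δ : ℤ} (f : PrimForm Δ) (S : Finset ℕ)
    (hS : ∀ q ∈ S, q.Prime) : ∃ x y : ℤ, ∀ q ∈ S, ¬ (q : ℤ) ∣ f.form.eval x y := by
  induction S using Finset.induction_on with
  | empty => exact ⟨0, 0, by simp⟩
  | insert q S hq ih =>
    obtain ⟨x, y, hxy⟩ := ih fun q hq => hS q (Finset.mem_insert_of_mem hq)
    have hqp : q.Prime := hS q (Finset.mem_insert_self _ _)
    have hqZ : Prime (q : ℤ) := Nat.prime_iff_prime_int.mp hqp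
    obtain ⟨x0, y0, h0⟩ : ∃ x0 y0 : ℤ, ¬ (q : ℤ) ∣ f.form.eval x0 y0 := by
      by_contra! h
      exact hqZ.not_isUnit (f.isUnit_of_dvd_eval h)
    have hcop : IsCoprime (∏ s ∈ S, (s : ℤ)) (q : ℤ) := by
      refine IsCoprime.prod_left fun s hs => Nat.isCoprime_iff_coprime.mpr ?_
      refine (Nat.coprime_primes (hS s (Finset.mem_insert_of_mem hs)) hqp).mpr ?_
      rintro rfl
      exact hq hs
    obtain ⟨u, v, huv⟩ := hcop
    set D := ∏ s ∈ S, (s : ℤ) with hD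
    -- a vector congruent to `(x, y)` modulo `D` and to `(x0, y0)` modulo `q`
    have congr : ∀ (d s t s' t' : ℤ), d ∣ s - s' → d ∣ t - t' →
        d ∣ f.form.eval s t → d ∣ f.form.eval s' t' := by
      intro d s t s' t' h1 h2 h3
      have : f.form.eval s' t' = f.form.eval s t - (s - s') * (f.form.a * (s + s') + f.form.b * t)
          - (t - t') * (f.form.b * s' + f.form.c * (t + t')) := by
        simp only [BQForm.eval]; ring
      rw [this]
      exact dvd_sub (dvd_sub h3 (h1.mul_right _)) (h2.mul_right _)
    refine ⟨x + u * D * (x0 - x), y + u * D * (y0 - y), fun s hs => ?_⟩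
    rcases Finset.mem_insert.mp hs with rfl | hs
    · refine fun h => h0 (congr _ _ _ _ _ ⟨v * (x - x0), ?_⟩ ⟨v * (y - y0), ?_⟩ h)
      · linear_combination (x0 - x) * huv
      · linear_combination (y0 - y) * huv
    · have hsD : (s : ℤ) ∣ D := Finset.dvd_prod_of_mem _ hs
      refine fun h => hxy s hs (congr _ _ _ _ _ ?_ ?_ h)
      · rw [add_sub_cancel_left]; exact (hsD.mul_left _).mul_right _
      · rw [add_sub_cancel_left]; exact (hsD.mul_left _).mul_right _

theorem PrimForm.exists_eval_isCoprime {Δ : ℤ} (f : PrimForm Δ) {M : ℤ} (hM : M ≠ 0) :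
    ∃ x y : ℤ, IsCoprime (f.form.eval x y) M := by
  obtain ⟨x, y, h⟩ := f.exists_eval_not_dvd M.natAbs.primeFactors
    fun q hq => Nat.prime_of_mem_primeFactors hq
  refine ⟨x, y, ?_⟩
  rw [Int.isCoprime_iff_gcd_eq_one]
  by_contra hg
  obtain ⟨q, hq, hqd⟩ := Nat.exists_prime_and_dvd hg
  have h1 : (q : ℤ) ∣ f.form.eval x y := (Int.natCast_dvd_natCast.mpr hqd).trans
    (Int.gcd_dvd_left _ _)
  have h2 : (q : ℤ) ∣ M := (Int.natCast_dvd_natCast.mpr hqd).trans (Int.gcd_dvd_right _ _)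
  refine h q ?_ h1
  exact Nat.mem_primeFactors.mpr ⟨hq, Int.natCast_dvd.mp h2, by simpa using hM⟩

/-- A genus consists of the classes whose values prime to `Δ` have the same assigned characters as
a given value `r` prime to `Δ`. -/
theorem IsGenus.cls_mem_iff {Δ : ℤ} {g : Finset (FormClass Δ)} (hg : IsGenus g) {r : ℤ}
    (hr : IsCoprime r Δ) (hrg : GenusRepresents g r) (f : PrimForm Δ) {x y : ℤ}
    (h : IsCoprime (f.form.eval x y) Δ) : f.cls ∈ g ↔ CharEq Δ (f.form.eval x y) r := by
  obtain ⟨C, hC⟩ := hg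
  have aux : ∀ (f : PrimForm Δ) (x y : ℤ), IsCoprime (f.form.eval x y) Δ →
      ∀ f₀ : PrimForm Δ, ∀ x₀ y₀ : ℤ, IsCoprime (f₀.form.eval x₀ y₀) Δ →
      (SameGenus f₀.cls f.cls ↔ CharEq Δ (f₀.form.eval x₀ y₀) (f.form.eval x y)) := by
    intro f x y h f₀ x₀ y₀ h₀
    constructor
    · rintro ⟨s, s', hs, hs', h1, h2, he⟩
      obtain ⟨x1, y1, rfl⟩ := (f₀.cls_represents _).mp h1
      obtain ⟨x2, y2, rfl⟩ := (f.cls_represents _).mp h2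
      have he : CharEq Δ _ _ := he
      exact ((f₀.charEq h₀ hs).trans he).trans (f.charEq hs' h)
    · intro he
      exact ⟨_, _, h₀, h, (f₀.cls_represents _).mpr ⟨_, _, rfl⟩,
        (f.cls_represents _).mpr ⟨_, _, rfl⟩, he⟩
  obtain ⟨f₀, rfl⟩ := C.exists_cls
  obtain ⟨C₁, h₁, hr₁⟩ := hrg
  obtain ⟨f₁, rfl⟩ := C₁.exists_cls
  obtain ⟨x₁, y₁, rfl⟩ := (f₁.cls_represents _).mp hr₁
  obtain ⟨x₀, y₀, h₀⟩ := f₀.exists_eval_isCoprime (ne_of_lt f₀.lt_zero)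
  have k₁ := (aux f₁ x₁ y₁ hr f₀ x₀ y₀ h₀).mp ((hC _).mp h₁)
  rw [hC, aux f x y h f₀ x₀ y₀ h₀]
  exact ⟨fun k => k.symm.trans k₁, fun k => k₁.trans k.symm⟩

/-! ### Every class of a genus represents a good value -/

theorem exists_sl_of_gcd_eq_one {x y : ℤ} (h : IsCoprime x y) :
    ∃ M : SL₂ℤ, M 0 0 = x ∧ M 1 0 = y := by
  obtain ⟨u, v, huv⟩ := h
  exact ⟨slMk x (-v) y u (by linear_combination huv), rfl, rfl⟩

/-- A nonzero value of a form is a square times the leading coefficient of an equivalent form. -/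
theorem PrimForm.exists_cls_eq_eval {Δ : ℤ} (f : PrimForm Δ) {x y : ℤ} (h : f.form.eval x y ≠ 0) :
    ∃ f' : PrimForm Δ, f'.cls = f.cls ∧ ∃ d : ℤ, f.form.eval x y = f'.form.eval d 0 := by
  have hg : Int.gcd x y ≠ 0 := fun hg => by
    rw [Int.gcd_eq_zero_iff] at hg
    rw [hg.1, hg.2] at h
    exact h (by simp [BQForm.eval])
  obtain ⟨x', hx⟩ := Int.gcd_dvd_left x y
  obtain ⟨y', hy⟩ := Int.gcd_dvd_right x y
  have hcop : IsCoprime x' y' := by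
    have e := Int.gcd_eq_gcd_ab x y
    refine ⟨Int.gcdA x y, Int.gcdB x y, ?_⟩
    refine mul_left_cancel₀ (Int.natCast_ne_zero.mpr hg) ?_
    linear_combination -e - Int.gcdA x y * hx - Int.gcdB x y * hy
  obtain ⟨M, h0, h1⟩ := exists_sl_of_gcd_eq_one hcop
  refine ⟨f.act M, f.cls_act M, Int.gcd x y, ?_⟩
  rw [PrimForm.eval_act, h0, h1, mul_zero, add_zero, mul_zero, add_zero, mul_comm x', mul_comm y',
    ← hx, ← hy]

section Good
variable {Δ : ℤ} {p : ℕ} [hp : Fact p.Prime] {r : ℤ}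

theorem PrimForm.exists_goodValue_leading (f : PrimForm Δ) (hr : ¬ (p : ℤ) ∣ r) {x y : ℤ}
    (h : GoodValue Δ p r (f.form.eval x y)) :
    ∃ f' : PrimForm Δ, f'.cls = f.cls ∧ GoodValue Δ p r f'.form.a := by
  have hpd := not_dvd_of_goodValue hr h
  obtain ⟨f', hf', d, hd⟩ := f.exists_cls_eq_eval (fun h0 => hpd (h0 ▸ dvd_zero _))
  refine ⟨f', hf', ?_⟩
  have ha : f'.form.eval 1 0 = f'.form.a := by simp [BQForm.eval]
  rw [hd] at hpd h
  rw [← ha, ← f'.goodValue_iff hr hpd ?_ (by simp)]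
  · exact h
  · rw [ha]; intro hpa; apply hpd; simp only [BQForm.eval]
    simp [hpa.mul_right]

/-- A form of discriminant prime to the odd prime `p` represents every residue class modulo `p`. -/
theorem PrimForm.exists_eval_modEq (f : PrimForm Δ) (h2 : p ≠ 2) (hpΔ : ¬ (p : ℤ) ∣ Δ)
    (ha : ¬ (p : ℤ) ∣ f.form.a) : ∃ x y : ℤ, ((f.form.eval x y : ℤ) : ZMod p) = (r : ZMod p) := by
  have ha0 : (f.form.a : ZMod p) ≠ 0 := fun e => ha ((ZMod.intCast_zmod_eq_zero_iff_dvd _ _).mp e)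
  have hΔ0 : (Δ : ZMod p) ≠ 0 := fun e => hpΔ ((ZMod.intCast_zmod_eq_zero_iff_dvd _ _).mp e)
  have h20 : (2 : ZMod p) ≠ 0 := by
    have : ((2 : ℕ) : ZMod p) ≠ 0 := fun e => by
      rw [ZMod.natCast_eq_zero_iff] at e
      exact h2 ((Nat.prime_dvd_prime_iff_eq hp.out Nat.prime_two).mp e)
    exact_mod_cast this
  -- `4 a f (x, y) = X ^ 2 - Δ Y ^ 2` with `X = 2 a x + b y` and `Y = y`
  obtain ⟨X, Y, hXY⟩ := FiniteField.exists_root_sum_quadratic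
    (f := (Polynomial.X ^ 2 : Polynomial (ZMod p)))
    (g := Polynomial.C (-(Δ : ZMod p)) * Polynomial.X ^ 2 +
      Polynomial.C (-(4 * (f.form.a : ZMod p) * r)))
    (Polynomial.degree_X_pow 2)
    (by
      have := Polynomial.degree_quadratic (b := (0 : ZMod p))
        (c := -(4 * (f.form.a : ZMod p) * (r : ZMod p)))
        (neg_ne_zero.mpr hΔ0)
      simpa using this)
    (by rw [ZMod.card]; exact (hp.out.eq_two_or_odd).resolve_left h2)
  simp only [Polynomial.eval_pow, Polynomial.eval_X, Polynomial.eval_add, Polynomial.eval_mul,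
    Polynomial.eval_C] at hXY
  have hne : (2 * (f.form.a : ZMod p)) ≠ 0 := mul_ne_zero h20 ha0
  obtain ⟨x, hx⟩ := ZMod.intCast_surjective
    ((X - (f.form.b : ZMod p) * Y) / (2 * (f.form.a : ZMod p)))
  obtain ⟨y, hy⟩ := ZMod.intCast_surjective Y
  refine ⟨x, y, ?_⟩
  have hX : 2 * (f.form.a : ZMod p) * x + f.form.b * y = X := by
    rw [hx, hy, mul_div_cancel₀ _ hne]; ring
  have hd : ((f.form.b ^ 2 - 4 * f.form.a * f.form.c : ℤ) : ZMod p) = Δ := by rw [f.disc_eq']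
  refine mul_left_cancel₀ (mul_ne_zero h20 hne) ?_
  rw [← hX, ← hy, ← hd] at hXY
  simp only [BQForm.eval]
  push_cast at hXY ⊢
  linear_combination hXY

/-- For a form of even discriminant `-4 n`, an odd value `a` and a second odd value `m` with
`a m = X² + n`: if `q = a r` is as the assigned characters at `2` demand, then `a` or `m` is good.
As `a² ≡ 1` modulo `8`, goodness of `m` is expressed by `m r ≡ (X² + n) q`. -/
theorem good_or_good {n q X : ℤ} (hX : (X ^ 2 + n) % 2 = 1) (hq : q % 2 = 1)
    (hn : (n % 4 = 1 ∨ n % 8 = 4 ∨ n % 8 = 0 → q % 4 = 1) ∧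
      (n % 8 = 6 ∨ n % 8 = 0 → q % 8 = 1 ∨ q % 8 = 7) ∧
      (n % 8 = 2 → q % 8 = 1 ∨ q % 8 = 3)) :
    (q % 4 = 1 ∧ (n % 4 = 0 → q % 8 = 1)) ∨
      ((X ^ 2 + n) * q % 4 = 1 ∧ (n % 4 = 0 → (X ^ 2 + n) * q % 8 = 1)) := by
  have e := Int.mul_emod (X ^ 2 + n) q 8
  have o := emod_eight_of_odd hX
  rcases sq_emod_eight X with b | b | b <;>
    rcases o with h1 | h1 | h1 | h1 <;>
    rcases emod_eight_of_odd hq with h2 | h2 | h2 | h2 <;> rw [h1, h2] at e <;> omega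

/-- If the values of a form prime to `Δ p²` have the assigned characters of `r`, then an
equivalent form has a good leading coefficient. -/
theorem PrimForm.exists_goodValue (f : PrimForm Δ) (hr : IsCoprime r (Δ * (p : ℤ) ^ 2))
    {x y : ℤ} (h : IsCoprime (f.form.eval x y) (Δ * (p : ℤ) ^ 2))
    (hχ : CharEq Δ (f.form.eval x y) r) :
    ∃ f' : PrimForm Δ, f'.cls = f.cls ∧ GoodValue Δ p r f'.form.a := by
  have hpd : (p : ℤ) ∣ Δ * (p : ℤ) ^ 2 := (dvd_pow_self _ two_ne_zero).mul_left _
  have hpm := not_dvd_of_isCoprime h hpd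
  have hpr := not_dvd_of_isCoprime hr hpd
  obtain ⟨f', hf', d, hd⟩ := f.exists_cls_eq_eval (fun h0 => hpm (h0 ▸ dvd_zero _))
  have hda : f'.form.eval d 0 = f'.form.a * d ^ 2 := by simp [BQForm.eval]
  have hpa : ¬ (p : ℤ) ∣ f'.form.a := fun e => hpm (by rw [hd, hda]; exact e.mul_right _)
  suffices ∃ x y, GoodValue Δ p r (f'.form.eval x y) by
    obtain ⟨x, y, hxy⟩ := this
    obtain ⟨f'', h1, h2⟩ := f'.exists_goodValue_leading hpr hxy
    exact ⟨f'', h1.trans hf', h2⟩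
  have ha : f'.form.eval 1 0 = f'.form.a := by simp [BQForm.eval]
  by_cases h2 : p = 2
  · subst h2
    have o := emod_two_of_not_dvd hpa
    have o' := emod_two_of_not_dvd hpr
    by_cases hΔ : Δ % 2 = 0
    · have : Δ % 4 = 0 := by have := f.emod_four; omega
      obtain ⟨n, hn⟩ : ∃ n, Δ = -4 * n := ⟨-(Δ / 4), by omega⟩
      have hb : f'.form.b % 2 = 0 := by
        have h1 := f'.disc_eq'
        have h3 : f'.form.b ^ 2 = 4 * (f'.form.a * f'.form.c - n) := by linear_combination h1 + hn
        rcases sq_emod_eight f'.form.b with b | b | b <;> omega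
      obtain ⟨b, hb⟩ : ∃ b, f'.form.b = 2 * b := ⟨f'.form.b / 2, by omega⟩
      have hdisc : f'.form.a * f'.form.c = b ^ 2 + n := by
        have h1 := f'.disc_eq'
        rw [hb] at h1
        linarith
      obtain ⟨k, hk⟩ : ∃ k : ℤ, ((b + f'.form.a * k) ^ 2 + n) % 2 = 1 := by
        refine ⟨b + n + 1, ?_⟩
        have e1 := Int.mul_emod f'.form.a (b + n + 1) 2
        rw [o, one_mul] at e1
        rcases sq_emod_eight (b + f'.form.a * (b + n + 1)) with h | h | h <;> omega
      have hak : f'.form.a * f'.form.eval k 1 = (b + f'.form.a * k) ^ 2 + n := by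
        simp only [BQForm.eval, hb]; linear_combination hdisc
      have ok : f'.form.eval k 1 % 2 = 1 := by
        rw [← hak, Int.mul_emod, o, one_mul, Int.emod_emod_of_dvd _ (dvd_refl 2)] at hk
        exact hk
      have hca : IsCoprime (f'.form.eval 1 0) Δ := by
        rw [ha]
        rw [hd, hda] at h
        exact h.of_mul_left_left.of_mul_right_left
      have hχa : CharEq Δ (f'.form.eval 1 0) r := by
        refine (f'.charEq hca ?_).trans (hd ▸ hχ)
        exact hd ▸ h.of_mul_right_left
      have hq := ((charEq_iff hca hr.of_mul_right_left).mp hχa).2 n hn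
      rw [ha] at hq
      have h16 : Δ % 16 = 0 ↔ n % 4 = 0 := by omega
      rcases good_or_good hk (mul_emod_two o o') hq with hgood | hgood
      · refine ⟨1, 0, ?_⟩
        rw [ha, goodValue_two_iff o o', h16]
        exact ⟨fun _ => hgood.1, hgood.2⟩
      · refine ⟨k, 1, ?_⟩
        rw [goodValue_two_iff ok o', h16]
        have e : ((b + f'.form.a * k) ^ 2 + n) * (f'.form.a * r) =
            f'.form.a ^ 2 * (f'.form.eval k 1 * r) := by rw [← hak]; ring
        have e8 := Int.mul_emod (f'.form.a ^ 2) (f'.form.eval k 1 * r) 8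
        have ha8 : f'.form.a ^ 2 % 8 = 1 := by
          rcases sq_emod_eight f'.form.a with h | h | h <;> omega
        rw [ha8, one_mul] at e8
        rw [e] at hgood
        exact ⟨fun _ => by omega, fun h => by have := hgood.2 h; omega⟩
    · refine ⟨1, 0, ?_⟩
      rw [ha, goodValue_two_iff o o']
      exact ⟨by omega, by omega⟩
  · by_cases hpΔ : (p : ℤ) ∣ Δ
    · refine ⟨d, 0, ?_⟩
      rw [← hd, goodValue_odd_iff h2 hpm hpr]
      exact hχ _ (.legendre p h2 hpΔ)
    · obtain ⟨x, y, hxy⟩ := f'.exists_eval_modEq (r := r) h2 hpΔ hpa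
      refine ⟨x, y, ?_⟩
      have hxy' : ¬ (p : ℤ) ∣ f'.form.eval x y := fun e => by
        rw [← ZMod.intCast_zmod_eq_zero_iff_dvd, hxy, ZMod.intCast_zmod_eq_zero_iff_dvd] at e
        exact hpr e
      rw [goodValue_odd_iff h2 hxy' hpr, legendreSym, hxy, legendreSym]

end Good

/-! ### Automorphs -/

theorem PrimForm.finite_setOf_act_eq {Δ : ℤ} (f f' : PrimForm Δ) :
    {M : SL₂ℤ | f.act M = f'}.Finite := by
  refine Set.Finite.of_finite_image (f := fun M : SL₂ℤ => ((M 0 0, M 1 0), (M 0 1, M 1 1)))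
    (((f.finite_repSet f'.form.a).prod (f.finite_repSet f'.form.c)).subset ?_) ?_
  · rintro _ ⟨M, rfl, rfl⟩
    exact ⟨rfl, rfl⟩
  · intro M _ N _ h
    simp only [Prod.mk.injEq] at h
    exact sl_ext h.1.1 h.2.1 h.1.2 h.2.2

/-- The matrices that carry `f` to `f'`. -/
noncomputable def PrimForm.isos {Δ : ℤ} (f f' : PrimForm Δ) : Finset SL₂ℤ :=
  (f.finite_setOf_act_eq f').toFinset

theorem PrimForm.mem_isos {Δ : ℤ} {f f' : PrimForm Δ} {M : SL₂ℤ} :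
    M ∈ f.isos f' ↔ f.act M = f' := by
  simp [PrimForm.isos]

theorem PrimForm.isos_eq_empty {Δ : ℤ} {f f' : PrimForm Δ} (h : f.cls ≠ f'.cls) :
    f.isos f' = ∅ := by
  refine Finset.eq_empty_of_forall_notMem fun M hM => h ?_
  exact PrimForm.cls_eq_iff.mpr ⟨M, PrimForm.mem_isos.mp hM⟩

/-- The isomorphisms between equivalent forms are a torsor under the automorphs. -/
theorem PrimForm.card_isos {Δ : ℤ} {f f' : PrimForm Δ} (h : f.cls = f'.cls) :
    (f.isos f').card = (f.isos f).card := by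
  obtain ⟨N, hN⟩ := PrimForm.cls_eq_iff.mp h
  refine Finset.card_bij' (fun M _ => M * N⁻¹) (fun M _ => M * N) ?_ ?_ ?_ ?_
  · intro M hM
    rw [PrimForm.mem_isos] at hM ⊢
    rw [PrimForm.act_mul, hM, ← PrimForm.act_eq_iff.mp hN]
  · intro M hM
    rw [PrimForm.mem_isos] at hM ⊢
    rw [PrimForm.act_mul, hM, hN]
  · intro M _; simp
  · intro M _; simp

/-- The automorphs of `a x² + b x y + c y²` are the matrices with rows `((τ - b u) / 2, -c u)`,
`(a u, (τ + b u) / 2)`, where `τ² - Δ u² = 4`. -/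
theorem PrimForm.exists_of_act_eq {Δ : ℤ} (f : PrimForm Δ) {M : SL₂ℤ} (h : f.act M = f) :
    ∃ u : ℤ, M 1 0 = f.form.a * u ∧ M 1 1 - M 0 0 = f.form.b * u ∧ -M 0 1 = f.form.c * u ∧
      (M 0 0 + M 1 1) ^ 2 - Δ * u ^ 2 = 4 := by
  have hdet := sl_det M
  have ha : f.form.eval (M 0 0) (M 1 0) = f.form.a := congrArg (fun g => g.form.a) h
  have hb : 2 * f.form.a * M 0 0 * M 0 1 + f.form.b * (M 0 0 * M 1 1 + M 0 1 * M 1 0)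
      + 2 * f.form.c * M 1 0 * M 1 1 = f.form.b := congrArg (fun g => g.form.b) h
  have hc : f.form.eval (M 0 1) (M 1 1) = f.form.c := congrArg (fun g => g.form.c) h
  simp only [BQForm.eval] at ha hc
  -- compare the Gram matrices in `Q M = (Mᵀ)⁻¹ Q`
  have e1 : f.form.a * (M 1 1 - M 0 0) = f.form.b * M 1 0 := by
    have h0 : f.form.a * M 0 0 * 2 + f.form.b * M 1 0 =
        2 * f.form.a * M 1 1 - f.form.b * M 1 0 := by
      linear_combination (2 * M 1 1) * ha - M 1 0 * hb
        - (2 * f.form.a * M 0 0 + f.form.b * M 1 0) * hdet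
    linarith
  have e2 : f.form.a * M 0 1 = -(f.form.c * M 1 0) := by
    have h0 : 2 * f.form.a * M 0 1 + f.form.b * M 1 1 =
        f.form.b * M 1 1 - 2 * f.form.c * M 1 0 := by
      linear_combination M 1 1 * hb - 2 * M 1 0 * hc
        - (2 * f.form.a * M 0 1 + f.form.b * M 1 1) * hdet
    linarith
  have e3 : f.form.c * (M 0 0 - M 1 1) = f.form.b * M 0 1 := by
    have h0 : f.form.b * M 0 1 + 2 * f.form.c * M 1 1 =
        2 * f.form.c * M 0 0 - f.form.b * M 0 1 := by
      linear_combination 2 * M 0 0 * hc - M 0 1 * hb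
        - (f.form.b * M 0 1 + 2 * f.form.c * M 1 1) * hdet
    linarith
  -- so `(γ, δ - α, -β)` is proportional to the primitive vector `(a, b, c)`
  obtain ⟨x, y, z, hxyz⟩ : ∃ x y z : ℤ, f.form.a * x + f.form.b * y + f.form.c * z = 1 := by
    have hp : Int.gcd (Int.gcd f.form.a f.form.b) f.form.c = 1 := f.primitive
    have h1 := Int.gcd_eq_gcd_ab (Int.gcd f.form.a f.form.b) f.form.c
    have h2 := Int.gcd_eq_gcd_ab f.form.a f.form.b
    rw [hp, Nat.cast_one] at h1
    set A := Int.gcdA (Int.gcd f.form.a f.form.b) f.form.c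
    exact ⟨Int.gcdA f.form.a f.form.b * A, Int.gcdB f.form.a f.form.b * A,
      Int.gcdB (Int.gcd f.form.a f.form.b) f.form.c,
      by linear_combination -h1 - A * h2⟩
  have u1 : M 1 0 = f.form.a * (x * M 1 0 + y * (M 1 1 - M 0 0) - z * M 0 1) := by
    linear_combination -M 1 0 * hxyz - y * e1 + z * e2
  have u2 : M 1 1 - M 0 0 = f.form.b * (x * M 1 0 + y * (M 1 1 - M 0 0) - z * M 0 1) := by
    linear_combination (-(M 1 1 - M 0 0)) * hxyz + x * e1 - z * e3
  have u3 : -M 0 1 = f.form.c * (x * M 1 0 + y * (M 1 1 - M 0 0) - z * M 0 1) := by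
    linear_combination M 0 1 * hxyz - x * e2 + y * e3
  refine ⟨x * M 1 0 + y * (M 1 1 - M 0 0) - z * M 0 1, u1, u2, u3, ?_⟩
  set u := x * M 1 0 + y * (M 1 1 - M 0 0) - z * M 0 1
  have hd := f.disc_eq'
  linear_combination 4 * hdet + u ^ 2 * hd + (M 1 1 - M 0 0 + f.form.b * u) * u2
    - 4 * M 1 0 * u3 - 4 * f.form.c * u * u1

/-- Below `-4` the only automorphs are `±1`. -/
theorem PrimForm.eq_or_eq_neg {Δ : ℤ} (f : PrimForm Δ) (hΔ : Δ < -4) {M : SL₂ℤ}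
    (h : f.act M = f) :
    M = 1 ∨ M = -1 := by
  obtain ⟨u, h1, h2, h3, h4⟩ := f.exists_of_act_eq h
  have hu : u = 0 := by
    by_contra hu
    have : 0 < u ^ 2 := sq_pos_of_ne_zero hu
    nlinarith [sq_nonneg (M 0 0 + M 1 1)]
  subst hu
  simp only [mul_zero, ne_eq, OfNat.ofNat_ne_zero, not_false_eq_true, zero_pow,
    sub_zero] at h1 h2 h3 h4
  have h5 : (M 0 0 + M 1 1 - 2) * (M 0 0 + M 1 1 + 2) = 0 := by linear_combination h4
  rcases mul_eq_zero.mp h5 with h5 | h5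
  · left
    refine sl_ext ?_ ?_ ?_ ?_ <;> simp <;> omega
  · right
    refine sl_ext ?_ ?_ ?_ ?_ <;> simp <;> omega

theorem PrimForm.eval_neg {Δ : ℤ} (f : PrimForm Δ) (x y : ℤ) :
    f.form.eval (-x) (-y) = f.form.eval x y := by simp only [BQForm.eval]; ring

theorem PrimForm.act_neg {Δ : ℤ} (f : PrimForm Δ) (M : SL₂ℤ) : f.act (-M) = f.act M := by
  refine PrimForm.eq_of_eval fun x y => ?_
  rw [PrimForm.eval_act, PrimForm.eval_act, ← PrimForm.eval_neg]
  simp only [Matrix.SpecialLinearGroup.coe_neg, Matrix.neg_apply]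
  congr 1 <;> ring

theorem sl_ne_neg (M : SL₂ℤ) : M ≠ -M := by
  intro h
  have h0 := sl_col_ne_zero M 0
  have h1 : M 0 0 = -M 0 0 := congrFun (congrFun (congrArg Subtype.val h) 0) 0
  have h2 : M 1 0 = -M 1 0 := congrFun (congrFun (congrArg Subtype.val h) 1) 0
  omega

/-- The solutions of `τ² - Δ u² = 4` in a box that contains all of them when `Δ ≤ -3`. -/
noncomputable def pellBox (Δ : ℤ) : Finset (ℤ × ℤ) :=
  (Finset.Icc (-2) 2 ×ˢ Finset.Icc (-1) 1).filter fun v => v.1 ^ 2 - Δ * v.2 ^ 2 = 4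

theorem PrimForm.card_isos_self_eq_card_pellBox {Δ : ℤ} (f : PrimForm Δ) :
    (f.isos f).card = (pellBox Δ).card := by
  have hΔ : Δ ≤ -3 := by have := f.emod_four; have := f.lt_zero; omega
  have ha := f.a_pos
  have hd := f.disc_eq'
  have hpar : ∀ τ u : ℤ, τ ^ 2 - Δ * u ^ 2 = 4 → (τ - f.form.b * u) % 2 = 0 := by
    intro τ u h
    have h1 : (2 : ℤ) ∣ (τ - f.form.b * u) ^ 2 :=
      ⟨2 - 2 * f.form.a * f.form.c * u ^ 2 + f.form.b ^ 2 * u ^ 2 - f.form.b * τ * u, by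
        linear_combination h - u ^ 2 * hd⟩
    exact Int.emod_eq_zero_of_dvd (Int.prime_two.dvd_of_dvd_pow h1)
  symm
  refine Finset.card_bij (fun v hv => slMk ((v.1 - f.form.b * v.2) / 2) (-(f.form.c * v.2))
    (f.form.a * v.2) ((v.1 - f.form.b * v.2) / 2 + f.form.b * v.2) ?_) ?_ ?_ ?_
  · have hv := (Finset.mem_filter.mp hv).2
    obtain ⟨k, hk⟩ : ∃ k, v.1 - f.form.b * v.2 = 2 * k :=
      ⟨_, (Int.mul_ediv_cancel' (Int.dvd_of_emod_eq_zero (hpar _ _ hv))).symm⟩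
    rw [hk, Int.mul_ediv_cancel_left _ two_ne_zero]
    have : v.1 = 2 * k + f.form.b * v.2 := by linarith
    rw [this] at hv
    linarith [show 4 * (k * (k + f.form.b * v.2) - -(f.form.c * v.2) * (f.form.a * v.2)) = 4 by
      linear_combination hv - v.2 ^ 2 * hd]
  · rintro ⟨τ, u⟩ hv
    have hv := (Finset.mem_filter.mp hv).2
    obtain ⟨k, hk⟩ : ∃ k, τ - f.form.b * u = 2 * k :=
      ⟨_, (Int.mul_ediv_cancel' (Int.dvd_of_emod_eq_zero (hpar _ _ hv))).symm⟩
    rw [PrimForm.mem_isos]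
    refine PrimForm.eq_of_eval fun x y => ?_
    simp only [PrimForm.eval_act, slMk_00, slMk_01, slMk_10, slMk_11]
    rw [hk, Int.mul_ediv_cancel_left _ two_ne_zero]
    have : τ = 2 * k + f.form.b * u := by linarith
    simp only at hv
    rw [this] at hv
    have h4 : k * (k + f.form.b * u) + f.form.a * f.form.c * u ^ 2 = 1 := by
      linarith [show 4 * (k * (k + f.form.b * u) + f.form.a * f.form.c * u ^ 2) = 4 by
        linear_combination hv - u ^ 2 * hd]
    simp only [BQForm.eval]
    linear_combination (f.form.a * x ^ 2 + f.form.b * x * y + f.form.c * y ^ 2) * h4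
  · rintro ⟨τ, u⟩ h1 ⟨τ', u'⟩ h2 h
    have e1 := hpar _ _ (Finset.mem_filter.mp h1).2
    have e2 := hpar _ _ (Finset.mem_filter.mp h2).2
    have c10 : f.form.a * u = f.form.a * u' := congrArg (fun M : SL₂ℤ => M 1 0) h
    have c00 : (τ - f.form.b * u) / 2 = (τ' - f.form.b * u') / 2 :=
      congrArg (fun M : SL₂ℤ => M 0 0) h
    have hu : u = u' := mul_left_cancel₀ ha.ne' c10
    subst hu
    have : τ = τ' := by simp only at e1 e2; omega
    rw [this]
  · intro M hM
    rw [PrimForm.mem_isos] at hM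
    obtain ⟨u, h1, h2, h3, h4⟩ := f.exists_of_act_eq hM
    have hu2 : u ^ 2 ≤ 1 := by nlinarith [sq_nonneg (M 0 0 + M 1 1)]
    have hτ2 : (M 0 0 + M 1 1) ^ 2 ≤ 2 ^ 2 := by nlinarith [sq_nonneg u]
    have hτ := abs_le.mp (abs_le_of_sq_le_sq hτ2 (by norm_num))
    have hu := abs_le.mp ((sq_le_one_iff_abs_le_one u).mp hu2)
    refine ⟨(M 0 0 + M 1 1, u), ?_, ?_⟩
    · rw [pellBox, Finset.mem_filter, Finset.mem_product, Finset.mem_Icc, Finset.mem_Icc]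
      exact ⟨⟨hτ, hu⟩, h4⟩
    · have e : (M 0 0 + M 1 1 - f.form.b * u) = 2 * M 0 0 := by rw [← h2]; ring
      refine sl_ext ?_ ?_ ?_ ?_
      · simp only [slMk_00]; rw [e, Int.mul_ediv_cancel_left _ two_ne_zero]
      · simp only [slMk_01]; rw [← h3, neg_neg]
      · simp only [slMk_10]; rw [h1]
      · simp only [slMk_11]; rw [e, Int.mul_ediv_cancel_left _ two_ne_zero, ← h2]; ring

/-- A form of discriminant `Δ` has `2 w` automorphs. -/
theorem PrimForm.card_isos_self {Δ : ℤ} (f : PrimForm Δ) : ((f.isos f).card : ℚ) = 2 * w Δ := by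
  have hΔ : Δ ≤ -3 := by have := f.emod_four; have := f.lt_zero; omega
  rw [f.card_isos_self_eq_card_pellBox, w]
  split_ifs with h3 h4
  · rw [h3, show (pellBox (-3)).card = 6 by decide]; norm_num
  · rw [h4, show (pellBox (-4)).card = 4 by decide]; norm_num
  · have h4 : Δ < -4 := by have := f.emod_four; omega
    have : pellBox Δ = {(2, 0), (-2, 0)} := by
      ext ⟨τ, u⟩
      simp only [pellBox, Finset.mem_filter, Finset.mem_product, Finset.mem_Icc, Finset.mem_insert,
        Finset.mem_singleton, Prod.mk.injEq]
      constructor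
      · rintro ⟨⟨hτ, hu⟩, h⟩
        have hu0 : u = 0 := by
          by_contra hu
          have : 0 < u ^ 2 := sq_pos_of_ne_zero hu
          nlinarith [sq_nonneg τ]
        subst hu0
        have h5 : (τ - 2) * (τ + 2) = 0 := by linear_combination h
        rcases mul_eq_zero.mp h5 with h5 | h5 <;> omega
      · rintro (⟨rfl, rfl⟩ | ⟨rfl, rfl⟩) <;> norm_num
    rw [this]
    norm_num

/-! ### Lines modulo `p` -/

section Lines
variable {Δ : ℤ} {p : ℕ} [hp : Fact p.Prime] {r : ℤ}

/-- Representatives of the points of the projective line over `ZMod p`: `none` stands for the point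
at infinity `(1 : 0)` and `some k` for `(k : 1)`. -/
def lineVec : Option (ZMod p) → ℤ × ℤ
  | none => (1, 0)
  | some k => (k.val, 1)

theorem lineVec_not_dvd (k : Option (ZMod p)) :
    ¬ ((p : ℤ) ∣ (lineVec k).1 ∧ (p : ℤ) ∣ (lineVec k).2) := by
  rintro ⟨h1, h2⟩
  have hpr := (prime_int p).not_dvd_one
  cases k with
  | none => exact hpr h1
  | some k => exact hpr h2

theorem cast_val (k : ZMod p) : (((k.val : ℕ) : ℤ) : ZMod p) = k := by
  rw [Int.cast_natCast, ZMod.natCast_val, ZMod.cast_id]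

theorem existsUnique_lineVec {x y : ℤ} (h : ¬ ((p : ℤ) ∣ x ∧ (p : ℤ) ∣ y)) :
    ∃! k : Option (ZMod p), (p : ℤ) ∣ (lineVec k).1 * y - (lineVec k).2 * x := by
  by_cases hy : (p : ℤ) ∣ y
  · have hx : ¬ (p : ℤ) ∣ x := fun hx => h ⟨hx, hy⟩
    refine ⟨none, by simpa [lineVec] using hy, ?_⟩
    rintro (_ | k) hk
    · rfl
    · refine absurd ?_ hx
      simp only [lineVec, one_mul] at hk
      exact (dvd_sub_right (hy.mul_left _)).mp hk
  · have hy0 : (y : ZMod p) ≠ 0 := fun e => hy ((ZMod.intCast_zmod_eq_zero_iff_dvd _ _).mp e)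
    refine ⟨some ((x : ZMod p) / y), ?_, ?_⟩
    · simp only [lineVec, one_mul]
      rw [← ZMod.intCast_zmod_eq_zero_iff_dvd, Int.cast_sub, Int.cast_mul, cast_val,
        div_mul_cancel₀ _ hy0, sub_self]
    · rintro (_ | k) hk
      · exact absurd (by simpa [lineVec] using hk) hy
      · simp only [lineVec, one_mul] at hk
        rw [← ZMod.intCast_zmod_eq_zero_iff_dvd, Int.cast_sub, Int.cast_mul, cast_val,
          sub_eq_zero] at hk
        rw [← hk, mul_div_cancel_right₀ _ hy0]

theorem exists_sl_of_lineVec (k : Option (ZMod p)) :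
    ∃ M : SL₂ℤ, M 0 1 = (lineVec k).1 ∧ M 1 1 = (lineVec k).2 := by
  cases k with
  | none => exact ⟨slMk 0 1 (-1) 0 (by norm_num), rfl, rfl⟩
  | some k => exact ⟨slMk 1 k.val 0 1 (by norm_num), rfl, rfl⟩

theorem sl_col_not_dvd (M : SL₂ℤ) (j : Fin 2) : ¬ ((p : ℤ) ∣ M 0 j ∧ (p : ℤ) ∣ M 1 j) := by
  rintro ⟨h0, h1⟩
  refine (prime_int p).not_dvd_one ?_
  rw [← sl_det M]
  fin_cases j
  · exact dvd_sub (h0.mul_right _) (h1.mul_left _)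
  · exact dvd_sub (h1.mul_left _) (h0.mul_right _)

/-- Proportionality modulo `p` is transitive. -/
theorem dvd_det_trans {x y x' y' u v : ℤ} (h : ¬ ((p : ℤ) ∣ u ∧ (p : ℤ) ∣ v))
    (h1 : (p : ℤ) ∣ u * y - v * x) (h2 : (p : ℤ) ∣ u * y' - v * x') :
    (p : ℤ) ∣ x * y' - y * x' := by
  have hpr := prime_int p
  by_contra hd
  refine h ⟨?_, ?_⟩
  · refine (hpr.dvd_or_dvd (b := x * y' - y * x') ?_).resolve_right hd
    have e : u * (x * y' - y * x') = x * (u * y' - v * x') - x' * (u * y - v * x) := by ring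
    rw [e]
    exact dvd_sub (h2.mul_left _) (h1.mul_left _)
  · refine (hpr.dvd_or_dvd (b := x * y' - y * x') ?_).resolve_right hd
    have e : v * (x * y' - y * x') = y * (u * y' - v * x') - y' * (u * y - v * x) := by ring
    rw [e]
    exact dvd_sub (h2.mul_left _) (h1.mul_left _)

theorem BQForm.not_dvd_eval_of_dvd_det (f : BQForm) {x y x' y' : ℤ}
    (h' : ¬ ((p : ℤ) ∣ x' ∧ (p : ℤ) ∣ y')) (hd : (p : ℤ) ∣ x * y' - y * x')
    (h : ¬ (p : ℤ) ∣ f.eval x y) : ¬ (p : ℤ) ∣ f.eval x' y' := by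
  intro hf
  have hpr := prime_int p
  refine h' ⟨?_, ?_⟩
  · have e : x' ^ 2 * f.eval x y = x ^ 2 * f.eval x' y' - (x * y' - y * x') *
        (f.b * x * x' + f.c * (x * y' + y * x')) := by
      simp only [BQForm.eval]; ring
    have : (p : ℤ) ∣ x' ^ 2 * f.eval x y := by
      rw [e]; exact dvd_sub (hf.mul_left _) (hd.mul_right _)
    exact hpr.dvd_of_dvd_pow ((hpr.dvd_or_dvd this).resolve_right h)
  · have e : y' ^ 2 * f.eval x y = y ^ 2 * f.eval x' y' + (x * y' - y * x') *
        (f.b * y * y' + f.a * (x * y' + y * x')) := by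
      simp only [BQForm.eval]; ring
    have : (p : ℤ) ∣ y' ^ 2 * f.eval x y := by
      rw [e]; exact dvd_add (hf.mul_left _) (hd.mul_right _)
    exact hpr.dvd_of_dvd_pow ((hpr.dvd_or_dvd this).resolve_right h)

/-- The affine permutation `k ↦ α k + β` of `ZMod p`. -/
def affinePerm {α : ZMod p} (hα : α ≠ 0) (β : ZMod p) : Equiv.Perm (ZMod p) :=
  (Equiv.mulLeft₀ α hα).trans (Equiv.addRight β)

theorem affinePerm_apply {α : ZMod p} (hα : α ≠ 0) (β k : ZMod p) :
    affinePerm hα β k = α * k + β := rfl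

/-- For odd `p`, completing the square: `4 a f (k, 1) = (2 a k + b)² - Δ`. -/
theorem exists_perm_goodValue_odd (h2 : p ≠ 2) :
    ∃ Q : ZMod p → Prop, ∀ f : PrimForm Δ, GoodValue Δ p r f.form.a →
      ∃ φ : Equiv.Perm (ZMod p), ∀ k, GoodValue Δ p r (f.form.eval k.val 1) ↔ Q (φ k) := by
  refine ⟨fun X => quadraticChar (ZMod p) (X ^ 2 - Δ) = 1, fun f hf => ?_⟩
  rw [GoodValue, if_neg h2] at hf
  have h20 : (2 : ZMod p) ≠ 0 := by
    have : ((2 : ℕ) : ZMod p) ≠ 0 := fun e => by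
      rw [ZMod.natCast_eq_zero_iff] at e
      exact h2 ((Nat.prime_dvd_prime_iff_eq hp.out Nat.prime_two).mp e)
    exact_mod_cast this
  have ha : (f.form.a : ZMod p) ≠ 0 := fun e => by
    rw [(legendreSym.eq_zero_iff p _).mpr (by rw [Int.cast_mul, e, mul_zero])] at hf
    norm_num at hf
  refine ⟨affinePerm (mul_ne_zero h20 ha) f.form.b, fun k => ?_⟩
  rw [GoodValue, if_neg h2, affinePerm_apply]
  beta_reduce
  have e1 : 4 * f.form.a * f.form.eval k.val 1 =
      (2 * f.form.a * k.val + f.form.b) ^ 2 - Δ := by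
    simp only [BQForm.eval]; linear_combination -f.disc_eq'
  have e2 : quadraticChar (ZMod p) ((2 * (f.form.a : ZMod p) * k + f.form.b) ^ 2 - Δ) =
      legendreSym p (4 * f.form.a * f.form.eval k.val 1) := by
    rw [legendreSym, e1]
    push_cast
    rw [ZMod.natCast_val, ZMod.cast_id]
  have h2' : ((2 : ℤ) : ZMod p) ≠ 0 := by exact_mod_cast h20
  rw [e2, show 4 * f.form.a * f.form.eval k.val 1 =
      2 ^ 2 * (f.form.a * f.form.eval k.val 1) by ring,
    legendreSym.mul p (2 ^ 2), legendreSym.sq_one' p h2', one_mul, legendreSym.mul, legendreSym.mul]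
  rw [legendreSym.mul] at hf
  rcases legendreSym.eq_one_or_neg_one p ha with h | h <;> rw [h] at hf ⊢
  · rw [mul_one] at hf; rw [hf]
  · have : legendreSym p r = -1 := by linarith
    rw [this]

/-- For `p = 2` and even `Δ = -4 n`, `b = 2 b'`: `a f (k, 1) = (b' + a k)² + n`. -/
theorem exists_perm_goodValue_two (hr : ¬ ((2 : ℕ) : ℤ) ∣ r) :
    ∃ Q : ZMod 2 → Prop, ∀ f : PrimForm Δ, GoodValue Δ 2 r f.form.a →
      ∃ φ : Equiv.Perm (ZMod 2), ∀ k, GoodValue Δ 2 r (f.form.eval k.val 1) ↔ Q (φ k) := by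
  have o' := emod_two_of_not_dvd hr
  have iff_odd : ∀ m, GoodValue Δ 2 r m ↔
      m % 2 = 1 ∧ (Δ % 2 = 0 → m * r % 4 = 1) ∧ (Δ % 16 = 0 → m * r % 8 = 1) := fun m =>
    ⟨fun h => have o := emod_two_of_not_dvd (not_dvd_of_goodValue hr h)
      ⟨o, (goodValue_two_iff o o').mp h⟩, fun h => (goodValue_two_iff h.1 o').mpr h.2⟩
  by_cases hΔ : Δ % 2 = 0
  · refine ⟨fun X => if X = 0 then -(Δ / 4) % 4 = 1 else -(Δ / 4) % 8 = 0, fun f hf => ?_⟩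
    have hfa := (iff_odd _).mp hf
    have : Δ % 4 = 0 := by have := f.emod_four; omega
    obtain ⟨n, hn⟩ : ∃ n, Δ = -4 * n := ⟨-(Δ / 4), by omega⟩
    have hn' : -(Δ / 4) = n := by omega
    have hb : f.form.b % 2 = 0 := by
      have h1 := f.disc_eq'
      have h3 : f.form.b ^ 2 = 4 * (f.form.a * f.form.c - n) := by linear_combination h1 + hn
      rcases sq_emod_eight f.form.b with b | b | b <;> omega
    obtain ⟨b, hb⟩ : ∃ b, f.form.b = 2 * b := ⟨f.form.b / 2, by omega⟩
    have hdisc : f.form.a * f.form.c = b ^ 2 + n := by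
      have h1 := f.disc_eq'
      rw [hb] at h1
      linarith
    refine ⟨affinePerm one_ne_zero (b : ZMod 2), fun k => ?_⟩
    rw [hn', affinePerm_apply, one_mul]
    set X := b + f.form.a * k.val with hX
    have hXm : (k + (b : ZMod 2)) = 0 ↔ X % 2 = 0 := by
      have : k + (b : ZMod 2) = ((X : ℤ) : ZMod 2) := by
        have ha1 : (f.form.a : ZMod 2) = 1 := by
          have h1 : ((f.form.a : ℤ) : ZMod 2) = ((1 : ℤ) : ZMod 2) :=
            (ZMod.intCast_eq_intCast_iff _ _ 2).mpr (by
              rw [Int.ModEq]; push_cast; omega)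
          simpa using h1
        rw [hX, Int.cast_add, Int.cast_mul, cast_val, ha1, one_mul, add_comm]
      rw [this, ZMod.intCast_zmod_eq_zero_iff_dvd, Int.dvd_iff_emod_eq_zero]
      norm_num
    have hak : f.form.a * f.form.eval k.val 1 = X ^ 2 + n := by
      simp only [BQForm.eval, hb, hX]; linear_combination hdisc
    rw [iff_odd]
    set m := f.form.eval k.val 1
    have h16 : Δ % 16 = 0 ↔ n % 4 = 0 := by omega
    rw [h16] at hfa ⊢
    obtain ⟨o, ha4, ha8⟩ := hfa
    have ha4 := ha4 hΔ
    -- as `a r` is `1` modulo `4` or `8`, `m r` may be replaced by `a m`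
    have e1 := Int.mul_emod (f.form.a * r) (f.form.a * m) 8
    have e2 : f.form.a * r * (f.form.a * m) = f.form.a ^ 2 * (m * r) := by ring
    have e3 := Int.mul_emod (f.form.a ^ 2) (m * r) 8
    have e4 : f.form.a ^ 2 % 8 = 1 := by
      rcases sq_emod_eight f.form.a with h | h | h <;> omega
    have e5 := Int.mul_emod f.form.a m 2
    rw [o, one_mul, Int.emod_emod_of_dvd _ (dvd_refl 2)] at e5
    rw [e2] at e1
    rw [e4, one_mul] at e3
    rw [hak] at e1 e5
    have key : (m % 2 = 1 ∧ (Δ % 2 = 0 → m * r % 4 = 1) ∧ (n % 4 = 0 → m * r % 8 = 1)) ↔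
        ((X ^ 2 + n) % 4 = 1 ∧ (n % 4 = 0 → (X ^ 2 + n) % 8 = 1)) := by
      have hm2 : m % 2 = 1 ↔ m * r % 2 = 1 := by
        rw [Int.mul_emod, o', mul_one, Int.emod_emod_of_dvd _ (dvd_refl 2)]
      have har : f.form.a * r % 8 = 1 ∨ f.form.a * r % 8 = 5 := by omega
      rcases har with h | h <;> rw [h] at e1 <;> omega
    rw [key]
    beta_reduce
    rcases sq_emod_eight X with h | h | h
    · rw [if_pos (hXm.mpr (by omega))]; omega
    · rw [if_pos (hXm.mpr (by omega))]; omega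
    · rw [if_neg (fun e => by have := hXm.mp e; omega)]; omega
  · refine ⟨fun _ => Δ % 8 = 5, fun f hf => ⟨1, fun k => ?_⟩⟩
    have o := ((iff_odd _).mp hf).1
    have h4 := f.emod_four
    have hd := f.disc_eq'
    have hb : f.form.b % 2 = 1 := by
      by_contra hb
      have : f.form.b ^ 2 % 2 = 0 := by rw [sq, Int.mul_emod, Int.emod_two_ne_one.mp hb]; rfl
      rw [mul_assoc] at hd
      omega
    have hb8 : f.form.b ^ 2 % 8 = 1 := by
      rcases sq_emod_eight f.form.b with h | h | h <;> omega
    have hc : f.form.c % 2 = 1 ↔ Δ % 8 = 5 := by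
      have e := Int.mul_emod f.form.a f.form.c 2
      rw [o, one_mul, Int.emod_emod_of_dvd _ (dvd_refl 2)] at e
      rw [mul_assoc] at hd
      omega
    have hk : f.form.eval k.val 1 % 2 = f.form.c % 2 := by
      have : k.val = 0 ∨ k.val = 1 := by have := ZMod.val_lt k; omega
      rcases this with h | h <;> rw [h] <;> simp only [BQForm.eval] <;> push_cast <;> ring_nf
      omega
    rw [iff_odd, hk, hc]
    omega

/-- The number of lines modulo `p` on which the values of `f` are good. -/
noncomputable def PrimForm.numGoodLines (p : ℕ) [Fact p.Prime] (r : ℤ) (f : PrimForm Δ) : ℕ :=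
  {k : Option (ZMod p) | GoodValue Δ p r (f.form.eval (lineVec k).1 (lineVec k).2)}.ncard

/-- The number of good lines depends on the discriminant only. -/
theorem exists_numGoodLines_eq (Δ : ℤ) (hr : ¬ (p : ℤ) ∣ r) :
    ∃ N, ∀ f : PrimForm Δ, GoodValue Δ p r f.form.a → f.numGoodLines p r = N := by
  obtain ⟨Q, hQ⟩ : ∃ Q : ZMod p → Prop, ∀ f : PrimForm Δ, GoodValue Δ p r f.form.a →
      ∃ φ : Equiv.Perm (ZMod p), ∀ k, GoodValue Δ p r (f.form.eval k.val 1) ↔ Q (φ k) := by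
    by_cases h2 : p = 2
    · subst h2
      exact exists_perm_goodValue_two hr
    · exact exists_perm_goodValue_odd h2
  refine ⟨{k : Option (ZMod p) | ∀ x ∈ k, Q x}.ncard, fun f hf => ?_⟩
  obtain ⟨φ, hφ⟩ := hQ f hf
  have : {k : Option (ZMod p) | GoodValue Δ p r (f.form.eval (lineVec k).1 (lineVec k).2)} =
      (Equiv.optionCongr φ) ⁻¹' {k : Option (ZMod p) | ∀ x ∈ k, Q x} := by
    ext k
    cases k with
    | none =>
      have : f.form.eval 1 0 = f.form.a := by simp [BQForm.eval]
      simp [lineVec, this, hf]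
    | some k => simpa [lineVec] using hφ k
  rw [PrimForm.numGoodLines, this, Set.ncard_preimage_of_injective_subset_range
    (Equiv.injective _) (by simp)]

end Lines

/-! ### Counting pairs of a form and a sublattice -/

section Count
variable {Δ : ℤ} {p : ℕ} [hp : Fact p.Prime] {r : ℤ}

/-- If `G` corresponds to `g`, then `g` consists of the classes whose values prime to `Δ` have the
assigned characters of `r`, where `r` is any value of `G` prime to `Δ p²`. -/
theorem cls_mem_iff_charEq {g : Finset (FormClass Δ)} {G : Finset (FormClass (Δ * (p : ℤ) ^ 2))}
    (hg : IsGenus g) (hG : IsGenus G) (hcorr : Corresponds G g)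
    (hr : IsCoprime r (Δ * (p : ℤ) ^ 2)) (hrG : GenusRepresents G r) (f : PrimForm Δ) {x y : ℤ}
    (h : IsCoprime (f.form.eval x y) Δ) : f.cls ∈ g ↔ CharEq Δ (f.form.eval x y) r := by
  obtain ⟨r₁, r₂, hr₁, hr₂, hg₁, ⟨F, hF, hFr⟩, hχ⟩ := hcorr
  have hχ : CharEq Δ r₁ r₂ := hχ
  have hχ2 : CharEq Δ r₂ r := by
    obtain ⟨F, rfl⟩ := F.exists_cls
    obtain ⟨x, y, rfl⟩ := (F.cls_represents _).mp hFr
    exact ((charEq_mul_sq_iff f.emod_four hr₂ hr).mp ((hG.cls_mem_iff hr hrG F hr₂).mp hF)).1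
  rw [hg.cls_mem_iff hr₁.of_mul_right_left hg₁ f h]
  exact ⟨fun h => (h.trans hχ).trans hχ2, fun h => (h.trans hχ2.symm).trans hχ.symm⟩

/-- The class of `f (p x, y)` lies in `G` exactly if the class of `f` lies in `g` and the value
`f (0, 1)` is good. -/
theorem scale_cls_mem_iff {g : Finset (FormClass Δ)} {G : Finset (FormClass (Δ * (p : ℤ) ^ 2))}
    (hg : IsGenus g) (hG : IsGenus G) (hcorr : Corresponds G g)
    (hr : IsCoprime r (Δ * (p : ℤ) ^ 2)) (hrG : GenusRepresents G r) (f : PrimForm Δ)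
    (hc : ¬ (p : ℤ) ∣ f.form.c) :
    (f.scale hc).cls ∈ G ↔ f.cls ∈ g ∧ GoodValue Δ p r f.form.c := by
  have hpd : (p : ℤ) ∣ Δ * (p : ℤ) ^ 2 := (dvd_pow_self _ two_ne_zero).mul_left _
  have hpr := not_dvd_of_isCoprime hr hpd
  obtain ⟨x, y, hxy⟩ := (f.scale hc).exists_eval_isCoprime (ne_of_lt (f.scale hc).lt_zero)
  rw [hG.cls_mem_iff hr hrG _ hxy, charEq_mul_sq_iff f.emod_four hxy hr]
  rw [PrimForm.eval_scale] at hxy ⊢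
  have e1 : GoodValue Δ p r (f.form.eval (p * x) y) ↔ GoodValue Δ p r f.form.c := by
    have h01 : f.form.eval 0 1 = f.form.c := by simp [BQForm.eval]
    rw [← h01]
    refine f.goodValue_iff hpr (not_dvd_of_isCoprime hxy hpd) (h01.symm ▸ hc) ⟨x, by ring⟩
  rw [e1, cls_mem_iff_charEq hg hG hcorr hr hrG f hxy.of_mul_right_left]

variable {G : Finset (FormClass (Δ * (p : ℤ) ^ 2))} {ρ : FormClass (Δ * (p : ℤ) ^ 2) → PrimForm Δ}
  {hρ : ∀ F, ¬ (p : ℤ) ∣ (ρ F).form.c}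

open Classical in
/-- For a vector `(u, v)` that does not vanish modulo `p`, there are two pairs of a class `F` in `G`
and an embedding of the corresponding lattice into the one of `f` whose image contains `(u, v)`, if
`f (u, v)` is good, and none otherwise. -/
theorem sum_card_isos_filter (f : PrimForm Δ) (hρF : ∀ F, ((ρ F).scale (hρ F)).cls = F)
    (hpr : ¬ (p : ℤ) ∣ r)
    (hG : ∀ (f' : PrimForm Δ) (hc : ¬ (p : ℤ) ∣ f'.form.c), f'.cls = f.cls →
      ((f'.scale hc).cls ∈ G ↔ GoodValue Δ p r f'.form.c))
    {u v : ℤ} (huv : ¬ ((p : ℤ) ∣ u ∧ (p : ℤ) ∣ v)) :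
    ∑ F ∈ G, ((f.isos (ρ F)).filter fun S => (p : ℤ) ∣ u * S 1 1 - v * S 0 1).card =
      if GoodValue Δ p r (f.form.eval u v) then 2 else 0 := by
  have hcS : ∀ (f' : PrimForm Δ) (S : SL₂ℤ), f.act S = f' →
      f.form.eval (S 0 1) (S 1 1) = f'.form.c := by
    rintro _ S rfl; rfl
  split_ifs with hgood
  · have hpu := not_dvd_of_goodValue hpr hgood
    obtain ⟨k, hk, -⟩ := existsUnique_lineVec huv
    obtain ⟨M, hM0, hM1⟩ := exists_sl_of_lineVec k
    have hdet : (p : ℤ) ∣ u * M 1 1 - v * M 0 1 := by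
      rw [hM0, hM1]
      exact dvd_neg.mp (hk.trans (dvd_of_eq (by ring)))
    have hcM : ¬ (p : ℤ) ∣ (f.act M).form.c :=
      f.form.not_dvd_eval_of_dvd_det (sl_col_not_dvd M 1) hdet hpu
    have hgM : GoodValue Δ p r (f.act M).form.c :=
      (f.goodValue_iff hpr hpu hcM hdet).mp hgood
    set F₀ := ((f.act M).scale hcM).cls with hF₀
    have hF₀G : F₀ ∈ G := (hG _ hcM (f.cls_act M)).mpr hgM
    obtain ⟨T, hT⟩ := PrimForm.cls_eq_iff.mp (hρF F₀)
    obtain ⟨N, hN, hN01⟩ := PrimForm.exists_act_of_scale_act hT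
    set S₀ := M * N⁻¹ with hS₀
    have hS₀act : f.act S₀ = ρ F₀ := by
      rw [hS₀, PrimForm.act_mul]; exact (PrimForm.act_eq_iff.mp hN).symm
    have hS₀det : (p : ℤ) ∣ u * S₀ 1 1 - v * S₀ 0 1 := by
      rw [hS₀, sl_mul_apply, sl_mul_apply, sl_inv_01, sl_inv_11]
      have e : u * (M 1 0 * -N 0 1 + M 1 1 * N 0 0) - v * (M 0 0 * -N 0 1 + M 0 1 * N 0 0) =
          N 0 0 * (u * M 1 1 - v * M 0 1) - N 0 1 * (u * M 1 0 - v * M 0 0) := by ring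
      rw [e]
      exact dvd_sub (hdet.mul_left _) (hN01.mul_right _)
    -- two embeddings with the same image differ by an automorph of the form of discriminant `Δ p²`
    have huniq : ∀ (F : FormClass (Δ * (p : ℤ) ^ 2)) (S : SL₂ℤ), f.act S = ρ F →
        (p : ℤ) ∣ u * S 1 1 - v * S 0 1 → F = F₀ ∧ (S = S₀ ∨ S = -S₀) := by
      intro F S hS hSdet
      have hT : (ρ F₀).act (S₀⁻¹ * S) = ρ F := by
        rw [← hS₀act, ← PrimForm.act_mul, mul_inv_cancel_left, hS]
      have hT01 : (p : ℤ) ∣ (S₀⁻¹ * S) 0 1 := by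
        rw [sl_mul_apply, sl_inv_00, sl_inv_01]
        have := dvd_det_trans huv hSdet hS₀det
        convert this using 1; ring
      obtain ⟨A, hA, h00, h01, h10, h11⟩ := PrimForm.scale_act (hρ F₀) (hρ F) hT hT01
      have hFF : F = F₀ := by
        rw [← hρF F, ← hρF F₀, ← hA, PrimForm.cls_act]
      subst hFF
      refine ⟨rfl, ?_⟩
      have hΔ : Δ * (p : ℤ) ^ 2 < -4 := by
        have h3 : Δ ≤ -3 := by have := f.emod_four; have := f.lt_zero; omega
        have h2 : (2 : ℤ) ≤ p := by exact_mod_cast hp.out.two_le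
        nlinarith
      have hp0 : (p : ℤ) ≠ 0 := (prime_int p).ne_zero
      rcases ((ρ F₀).scale (hρ F₀)).eq_or_eq_neg hΔ hA with rfl | rfl
      · left
        have : S₀⁻¹ * S = 1 := by
          refine sl_ext ?_ ?_ ?_ ?_
          · rw [← h00]
          · rw [h01]; simp
          · refine mul_left_cancel₀ hp0 ?_
            rw [← h10]; simp
          · rw [← h11]
        exact (inv_mul_eq_one.mp this).symm
      · right
        have : S₀⁻¹ * S = -1 := by
          refine sl_ext ?_ ?_ ?_ ?_
          · rw [← h00]
          · rw [h01]; simp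
          · refine mul_left_cancel₀ hp0 ?_
            rw [← h10]; simp
          · rw [← h11]
        rw [inv_mul_eq_iff_eq_mul.mp this]; simp
    rw [Finset.sum_eq_single_of_mem F₀ hF₀G]
    · have : (f.isos (ρ F₀)).filter (fun S => (p : ℤ) ∣ u * S 1 1 - v * S 0 1) = {S₀, -S₀} := by
        ext S
        rw [Finset.mem_filter, PrimForm.mem_isos, Finset.mem_insert, Finset.mem_singleton]
        constructor
        · rintro ⟨h1, h2⟩
          exact (huniq F₀ S h1 h2).2
        · rintro (rfl | rfl)
          · exact ⟨hS₀act, hS₀det⟩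
          · refine ⟨by rw [PrimForm.act_neg, hS₀act], ?_⟩
            simp only [Matrix.SpecialLinearGroup.coe_neg, Matrix.neg_apply]
            exact dvd_neg.mp (hS₀det.trans (dvd_of_eq (by ring)))
      rw [this, Finset.card_pair (sl_ne_neg S₀)]
    · intro F _ hF
      rw [Finset.card_eq_zero]
      refine Finset.filter_eq_empty_iff.mpr fun S hS hSdet => hF ?_
      exact (huniq F S (PrimForm.mem_isos.mp hS) hSdet).1
  · refine Finset.sum_eq_zero fun F hF => ?_
    rw [Finset.card_eq_zero]
    refine Finset.filter_eq_empty_iff.mpr fun S hS hSdet => hgood ?_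
    rw [PrimForm.mem_isos] at hS
    have hcl : (ρ F).cls = f.cls := by rw [← hS, PrimForm.cls_act]
    have hgF := (hG (ρ F) (hρ F) hcl).mp (by rw [hρF]; exact hF)
    have hcF := hρ F
    rw [← hcS _ S hS] at hgF hcF
    have hdet' : (p : ℤ) ∣ S 0 1 * v - S 1 1 * u :=
      dvd_neg.mp (hSdet.trans (dvd_of_eq (by ring)))
    exact (f.goodValue_iff hpr hcF (f.form.not_dvd_eval_of_dvd_det huv hdet' hcF) hdet').mp hgF

open Classical in
/-- Counting the pairs of the preceding lemma without reference to a vector: the image of each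
contains exactly one line modulo `p`. -/
theorem sum_card_isos (f : PrimForm Δ) (hρF : ∀ F, ((ρ F).scale (hρ F)).cls = F)
    (hpr : ¬ (p : ℤ) ∣ r)
    (hG : ∀ (f' : PrimForm Δ) (hc : ¬ (p : ℤ) ∣ f'.form.c), f'.cls = f.cls →
      ((f'.scale hc).cls ∈ G ↔ GoodValue Δ p r f'.form.c)) :
    ∑ F ∈ G, (f.isos (ρ F)).card = 2 * f.numGoodLines p r := by
  have h1 : ∀ F, (f.isos (ρ F)).card = ∑ k : Option (ZMod p), ((f.isos (ρ F)).filter fun S =>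
      (p : ℤ) ∣ (lineVec k).1 * S 1 1 - (lineVec k).2 * S 0 1).card := by
    intro F
    simp only [Finset.card_filter]
    rw [Finset.sum_comm, Finset.card_eq_sum_ones]
    refine Finset.sum_congr rfl fun S _ => ?_
    obtain ⟨k, hk, hk'⟩ := existsUnique_lineVec (p := p) (sl_col_not_dvd S 1)
    rw [Finset.sum_eq_single k]
    · rw [if_pos hk]
    · intro k' _ hkk'
      exact if_neg fun h => hkk' (hk' k' h)
    · intro h; exact absurd (Finset.mem_univ k) h
  simp only [h1]
  rw [Finset.sum_comm]
  simp only [sum_card_isos_filter f hρF hpr hG (lineVec_not_dvd _)]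
  rw [PrimForm.numGoodLines, ← Finset.sum_filter, Finset.sum_const, smul_eq_mul, mul_comm,
    ← Set.ncard_coe_finset]
  congr 2
  ext k; simp

/-- The representations of `n` by `f' (p x, y)`, where `f' = f ∘ S`, are those by `f` in the
sublattice `S (p ℤ × ℤ)`. -/
theorem PrimForm.repCount_scale {f f' : PrimForm Δ} (hc : ¬ (p : ℤ) ∣ f'.form.c) {S : SL₂ℤ}
    (hS : f.act S = f') (n : ℤ) :
    (f'.scale hc).form.repCount n =
      {v ∈ f.form.repSet n | (p : ℤ) ∣ v.1 * S 1 1 - v.2 * S 0 1}.ncard := by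
  subst hS
  have hdet := sl_det S
  have hp0 : (p : ℤ) ≠ 0 := (prime_int p).ne_zero
  refine Set.ncard_congr
    (fun v _ => (S 0 0 * (p * v.1) + S 0 1 * v.2, S 1 0 * (p * v.1) + S 1 1 * v.2)) ?_ ?_ ?_
  · rintro ⟨x, y⟩ hv
    have hv : ((f.act S).scale hc).form.eval x y = n := hv
    rw [PrimForm.eval_scale, PrimForm.eval_act] at hv
    exact ⟨hv, x, by linear_combination (p : ℤ) * x * hdet⟩
  · rintro ⟨x, y⟩ ⟨x', y'⟩ - - h
    simp only [Prod.mk.injEq] at h ⊢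
    obtain ⟨h1, h2⟩ := h
    refine ⟨mul_left_cancel₀ hp0 ?_, ?_⟩
    · linear_combination S 1 1 * h1 - S 0 1 * h2 + p * (x' - x) * hdet
    · linear_combination S 0 0 * h2 - S 1 0 * h1 + (y' - y) * hdet
  · rintro ⟨u, v⟩ ⟨hv, k, hk⟩
    have hv : f.form.eval u v = n := hv
    simp only at hk
    have e1 : S 0 0 * (p * k) + S 0 1 * (S 0 0 * v - S 1 0 * u) = u := by
      linear_combination u * hdet - S 0 0 * hk
    have e2 : S 1 0 * (p * k) + S 1 1 * (S 0 0 * v - S 1 0 * u) = v := by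
      linear_combination v * hdet - S 1 0 * hk
    refine ⟨(k, S 0 0 * v - S 1 0 * u), ?_, ?_⟩
    · change ((f.act S).scale hc).form.eval _ _ = n
      rw [PrimForm.eval_scale, PrimForm.eval_act, e1, e2, hv]
    · exact Prod.ext e1 e2

theorem PrimForm.ncard_repSet_dvd (f : PrimForm Δ) (n : ℕ) :
    {v ∈ f.form.repSet n | (p : ℤ) ∣ v.1 ∧ (p : ℤ) ∣ v.2}.ncard =
      if p ^ 2 ∣ n then f.form.repCount ((n / p ^ 2 : ℕ) : ℤ) else 0 := by
  have hp0 : (p : ℤ) ≠ 0 := (prime_int p).ne_zero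
  have hev : ∀ x y : ℤ, f.form.eval (p * x) (p * y) = p ^ 2 * f.form.eval x y := fun x y => by
    simp only [BQForm.eval]; ring
  split_ifs with h
  · obtain ⟨m, rfl⟩ := h
    rw [Nat.mul_div_cancel_left _ (pow_pos hp.out.pos 2)]
    symm
    refine Set.ncard_congr (fun v _ => (p * v.1, p * v.2)) ?_ ?_ ?_
    · rintro ⟨x, y⟩ hv
      have hv : f.form.eval x y = m := hv
      refine ⟨?_, dvd_mul_right _ _, dvd_mul_right _ _⟩
      change f.form.eval (p * x) (p * y) = _
      rw [hev, hv]; push_cast; ring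
    · rintro ⟨x, y⟩ ⟨x', y'⟩ - - h
      simp only [Prod.mk.injEq] at h
      exact Prod.ext (mul_left_cancel₀ hp0 h.1) (mul_left_cancel₀ hp0 h.2)
    · rintro ⟨u, v⟩ ⟨hv, ⟨x, hx⟩, ⟨y, hy⟩⟩
      simp only at hx hy
      subst hx hy
      have hv : f.form.eval (p * x) (p * y) = _ := hv
      rw [hev] at hv
      refine ⟨(x, y), ?_, rfl⟩
      push_cast at hv
      exact mul_left_cancel₀ (pow_ne_zero 2 hp0) hv
  · rw [Set.ncard_eq_zero ((f.finite_repSet n).subset (Set.sep_subset _ _))]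
    refine Set.eq_empty_of_forall_notMem ?_
    rintro ⟨u, v⟩ ⟨hv, ⟨x, hx⟩, ⟨y, hy⟩⟩
    simp only at hx hy
    subst hx hy
    have hv : f.form.eval (p * x) (p * y) = _ := hv
    rw [hev] at hv
    have hdvd : (p : ℤ) ^ 2 ∣ (n : ℤ) := ⟨_, hv.symm⟩
    exact h (by exact_mod_cast hdvd)

open Classical in
/-- The representations of `n` by `f`, counted with the sublattices that contain them. -/
theorem sum_card_isos_mul_repCount (f : PrimForm Δ) (hρF : ∀ F, ((ρ F).scale (hρ F)).cls = F)
    (hpr : ¬ (p : ℤ) ∣ r)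
    (hG : ∀ (f' : PrimForm Δ) (hc : ¬ (p : ℤ) ∣ f'.form.c), f'.cls = f.cls →
      ((f'.scale hc).cls ∈ G ↔ GoodValue Δ p r f'.form.c)) (n : ℕ) :
    ∑ F ∈ G, (f.isos (ρ F)).card * ((ρ F).scale (hρ F)).form.repCount n =
      2 * f.numGoodLines p r * (if p ^ 2 ∣ n then f.form.repCount ((n / p ^ 2 : ℕ) : ℤ) else 0) +
        2 * if GoodValue Δ p r n then f.form.repCount n else 0 := by
  set R := (f.finite_repSet n).toFinset with hR
  have hmemR : ∀ v, v ∈ R ↔ f.form.eval v.1 v.2 = n := fun v => by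
    rw [hR, Set.Finite.mem_toFinset]; rfl
  have hcardR : R.card = f.form.repCount n := (Set.ncard_eq_toFinset_card _ _).symm
  have h1 : ∀ F, (f.isos (ρ F)).card * ((ρ F).scale (hρ F)).form.repCount n =
      ∑ v ∈ R, ((f.isos (ρ F)).filter fun S => (p : ℤ) ∣ v.1 * S 1 1 - v.2 * S 0 1).card := by
    intro F
    simp only [Finset.card_filter]
    rw [Finset.sum_comm, ← smul_eq_mul, ← Finset.sum_const]
    refine Finset.sum_congr rfl fun S hS => ?_
    rw [PrimForm.repCount_scale (hρ F) (PrimForm.mem_isos.mp hS), ← Finset.card_filter,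
      ← Set.ncard_coe_finset]
    congr 1
    ext v
    simp [hR]
  simp only [h1]
  rw [Finset.sum_comm]
  have h2 : ∀ v ∈ R, ∑ F ∈ G, ((f.isos (ρ F)).filter fun S =>
      (p : ℤ) ∣ v.1 * S 1 1 - v.2 * S 0 1).card =
      (if (p : ℤ) ∣ v.1 ∧ (p : ℤ) ∣ v.2 then 2 * f.numGoodLines p r else 0) +
        if GoodValue Δ p r n then 2 else 0 := by
    intro v hv
    rw [hmemR] at hv
    split_ifs with hdvd hgood hgood
    · -- a good value is prime to `p`, hence not taken on at a multiple of `p`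
      refine absurd ?_ (not_dvd_of_goodValue hpr hgood)
      rw [← hv]
      simp only [BQForm.eval]
      exact dvd_add (dvd_add ((hdvd.1.pow two_ne_zero).mul_left _) (hdvd.2.mul_left _))
        ((hdvd.2.pow two_ne_zero).mul_left _)
    · rw [add_zero, ← sum_card_isos f hρF hpr hG]
      refine Finset.sum_congr rfl fun F _ => ?_
      rw [Finset.filter_true_of_mem]
      exact fun S _ => dvd_sub (hdvd.1.mul_right _) (hdvd.2.mul_right _)
    · rw [sum_card_isos_filter f hρF hpr hG hdvd, hv, if_pos hgood]
    · rw [sum_card_isos_filter f hρF hpr hG hdvd, hv, if_neg hgood]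
  rw [Finset.sum_congr rfl h2, Finset.sum_add_distrib, ← Finset.sum_filter, Finset.sum_const,
    Finset.sum_const, smul_eq_mul, smul_eq_mul, hcardR, ← PrimForm.ncard_repSet_dvd,
    ← Set.ncard_coe_finset]
  congr 1
  · rw [mul_comm]
    congr 2
    ext v
    simp [hR]
  · split_ifs <;> ring

end Count

/-! ### The identity of theta series -/

section Identity
variable {Δ : ℤ} {p : ℕ} [hp : Fact p.Prime] {r : ℤ}

/-- Every class of `g` contains a form with good leading coefficient. -/
theorem exists_cls_goodValue {g : Finset (FormClass Δ)} {G : Finset (FormClass (Δ * (p : ℤ) ^ 2))}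
    (hg : IsGenus g) (hG : IsGenus G) (hcorr : Corresponds G g)
    (hr : IsCoprime r (Δ * (p : ℤ) ^ 2)) (hrG : GenusRepresents G r) {C : FormClass Δ}
    (hC : C ∈ g) : ∃ f : PrimForm Δ, f.cls = C ∧ GoodValue Δ p r f.form.a := by
  obtain ⟨f, rfl⟩ := C.exists_cls
  have hp0 : (p : ℤ) ≠ 0 := (prime_int p).ne_zero
  obtain ⟨x, y, hxy⟩ := f.exists_eval_isCoprime
    (mul_ne_zero (ne_of_lt f.lt_zero) (pow_ne_zero 2 hp0))
  exact f.exists_goodValue hr hxy ((cls_mem_iff_charEq hg hG hcorr hr hrG f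
    hxy.of_mul_right_left).mp hC)

open Classical in
/-- The identity of theta series, coefficient by coefficient. -/
theorem coeff_theta_identity {g : Finset (FormClass Δ)}
    {G : Finset (FormClass (Δ * (p : ℤ) ^ 2))}
    (hg : IsGenus g) (hG : IsGenus G) (hcorr : Corresponds G g)
    (hr : IsCoprime r (Δ * (p : ℤ) ^ 2)) (hrG : GenusRepresents G r) (n : ℕ) :
    w Δ * ∑ F ∈ G, PowerSeries.coeff n F.theta =
      ∑ C ∈ g, (w Δ * ((G.card : ℚ) / (g.card : ℚ)) *
          (if p ^ 2 ∣ n then PowerSeries.coeff (n / p ^ 2) C.theta else 0) +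
        if GoodValue Δ p r n then PowerSeries.coeff n C.theta else 0) := by
  have hpr : ¬ (p : ℤ) ∣ r :=
    not_dvd_of_isCoprime hr ((dvd_pow_self _ two_ne_zero).mul_left _)
  have hB := fun f hc => scale_cls_mem_iff hg hG hcorr hr hrG f hc
  have hgne : g.Nonempty := by
    obtain ⟨_, _, _, _, ⟨C, hC, _⟩, _⟩ := hcorr
    exact ⟨C, hC⟩
  have hΔ : Δ % 4 = 0 ∨ Δ % 4 = 1 := by
    obtain ⟨C, -⟩ := hgne
    obtain ⟨f, -⟩ := C.exists_cls
    exact f.emod_four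
  choose ρ hρ hρF using fun F => FormClass.exists_scale (p := p) hΔ F
  have hσ : ∀ C : FormClass Δ, ∃ f : PrimForm Δ, f.cls = C ∧
      (C ∈ g → GoodValue Δ p r f.form.a) := by
    intro C
    by_cases hC : C ∈ g
    · obtain ⟨f, hf, hgood⟩ := exists_cls_goodValue hg hG hcorr hr hrG hC
      exact ⟨f, hf, fun _ => hgood⟩
    · obtain ⟨f, hf⟩ := C.exists_cls
      exact ⟨f, hf, fun h => absurd h hC⟩
  choose σ hσC hσg using hσ
  obtain ⟨N, hN⟩ := exists_numGoodLines_eq (p := p) Δ hpr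
  have hGC : ∀ C ∈ g, ∀ (f' : PrimForm Δ) (hc : ¬ (p : ℤ) ∣ f'.form.c), f'.cls = (σ C).cls →
      ((f'.scale hc).cls ∈ G ↔ GoodValue Δ p r f'.form.c) := by
    intro C hC f' hc hcl
    rw [hB f' hc, hcl, hσC]
    exact and_iff_right hC
  -- every class in `G` belongs to `2 w` embeddings into the lattices of `g`
  have hT : ∀ F ∈ G, ∑ C ∈ g, (((σ C).isos (ρ F)).card : ℚ) = 2 * w Δ := by
    intro F hF
    have hmem : (ρ F).cls ∈ g := ((hB (ρ F) (hρ F)).mp (by rw [hρF]; exact hF)).1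
    rw [Finset.sum_eq_single_of_mem _ hmem]
    · rw [PrimForm.card_isos (hσC _), PrimForm.card_isos_self]
    · intro C _ hC
      rw [PrimForm.isos_eq_empty (by rw [hσC]; exact hC), Finset.card_empty, Nat.cast_zero]
  have hcard : w Δ * G.card = N * g.card := by
    have h1 : ∑ F ∈ G, ∑ C ∈ g, (((σ C).isos (ρ F)).card : ℚ) = G.card * (2 * w Δ) := by
      rw [Finset.sum_congr rfl hT, Finset.sum_const, nsmul_eq_mul]
    have h2 : ∑ C ∈ g, ∑ F ∈ G, (((σ C).isos (ρ F)).card : ℚ) = g.card * (2 * N) := by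
      rw [← nsmul_eq_mul, ← Finset.sum_const]
      refine Finset.sum_congr rfl fun C hC => ?_
      have := sum_card_isos (σ C) hρF hpr (hGC C hC)
      rw [hN _ (hσg C hC)] at this
      exact_mod_cast this
    rw [Finset.sum_comm, h2] at h1
    linarith
  have hg0 : (g.card : ℚ) ≠ 0 := Nat.cast_ne_zero.mpr hgne.card_pos.ne'
  have hNeq : w Δ * ((G.card : ℚ) / (g.card : ℚ)) = N := by
    rw [← mul_div_assoc, hcard, mul_div_cancel_right₀ _ hg0]
  have hcoeffG : ∀ F : FormClass (Δ * (p : ℤ) ^ 2), PowerSeries.coeff n F.theta =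
      (((ρ F).scale (hρ F)).form.repCount n : ℚ) := fun F => by
    rw [← PrimForm.coeff_theta, hρF]
  have hcoeffg : ∀ (m : ℕ) (C : FormClass Δ), PowerSeries.coeff m C.theta =
      ((σ C).form.repCount m : ℚ) := fun m C => by
    rw [← PrimForm.coeff_theta, hσC]
  have hmain : ∑ F ∈ G, ∑ C ∈ g, (((σ C).isos (ρ F)).card : ℚ) * PowerSeries.coeff n F.theta =
      2 * (w Δ * ∑ F ∈ G, PowerSeries.coeff n F.theta) := by
    rw [← mul_assoc, Finset.mul_sum]
    refine Finset.sum_congr rfl fun F hF => ?_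
    rw [← Finset.sum_mul, hT F hF]
  rw [hNeq]
  refine mul_left_cancel₀ (two_ne_zero (α := ℚ)) ?_
  rw [← hmain, Finset.sum_comm, Finset.mul_sum]
  refine Finset.sum_congr rfl fun C hC => ?_
  have := sum_card_isos_mul_repCount (σ C) hρF hpr (hGC C hC) n
  rw [hN _ (hσg C hC)] at this
  simp only [hcoeffG, hcoeffg]
  generalize n / p ^ 2 = m at this ⊢
  have := congrArg (Nat.cast (R := ℚ)) this
  push_cast at this
  rw [this]
  ring

end Identity

/-- For odd `p`, the weighted sum of projections keeps the exponents that are good values. -/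
theorem sum_legendreSym_proj_coeff (p : ℕ) [hp : Fact p.Prime] (r n : ℕ)
    (hr : ¬ (p : ℤ) ∣ r) (a : ℚ) :
    ∑ i ∈ Finset.Icc 1 (p - 1), (((legendreSym p ((r : ℤ) * (i : ℤ)) : ℚ) + 1) / 2) *
      (if n ≡ i [MOD p] then a else 0) = if legendreSym p ((r : ℤ) * n) = 1 then a else 0 := by
  have hp1 := hp.out.two_le
  have hleg : ∀ i : ℕ, n ≡ i [MOD p] →
      legendreSym p ((r : ℤ) * i) = legendreSym p ((r : ℤ) * n) := by
    intro i hi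
    have : ((n : ℕ) : ZMod p) = (i : ZMod p) := (ZMod.natCast_eq_natCast_iff _ _ _).mpr hi
    simp only [legendreSym, Int.cast_mul, Int.cast_natCast, this]
  by_cases hn : p ∣ n
  · have h0 : legendreSym p ((r : ℤ) * n) = 0 := by
      rw [legendreSym.eq_zero_iff, ZMod.intCast_zmod_eq_zero_iff_dvd]
      exact (Int.natCast_dvd_natCast.mpr hn).mul_left _
    rw [if_neg (by rw [h0]; norm_num)]
    refine Finset.sum_eq_zero fun i hi => ?_
    rw [if_neg, mul_zero]
    intro h
    rw [Finset.mem_Icc] at hi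
    have := Nat.le_of_dvd (by omega) ((h.dvd_iff dvd_rfl).mp hn)
    omega
  · have hmod : n % p ∈ Finset.Icc 1 (p - 1) := by
      have h1 := Nat.mod_lt n hp.out.pos
      have h2 : n % p ≠ 0 := fun h => hn (Nat.dvd_of_mod_eq_zero h)
      rw [Finset.mem_Icc]; omega
    rw [Finset.sum_eq_single_of_mem _ hmod]
    · rw [if_pos (Nat.mod_modEq n p).symm, hleg _ (Nat.mod_modEq n p).symm]
      have hne : (((r : ℤ) * n : ℤ) : ZMod p) ≠ 0 := by
        rw [Ne, ZMod.intCast_zmod_eq_zero_iff_dvd]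
        intro h
        rcases (prime_int p).dvd_or_dvd h with h | h
        · exact hr h
        · exact hn (Int.natCast_dvd_natCast.mp h)
      rcases legendreSym.eq_one_or_neg_one p hne with h | h <;> rw [h] <;> norm_num
    · intro i hi hne
      rw [if_neg, mul_zero]
      intro h
      rw [Finset.mem_Icc] at hi
      refine hne ?_
      have h1 : n % p = i % p := h
      rw [h1, Nat.mod_eq_of_lt (by omega)]

end GenusTheta

theorem corollary5p2 (Δ : ℤ) (hΔ : Δ < 0) (p : ℕ) [Fact p.Prime]
    (g : Finset (GenusTheta.FormClass Δ)) (G : Finset (GenusTheta.FormClass (Δ * (p : ℤ) ^ 2)))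
    (hg : GenusTheta.IsGenus g) (hG : GenusTheta.IsGenus G)
    (hcorr : GenusTheta.Corresponds G g)
    (r : ℕ) (hr : IsCoprime (r : ℤ) (Δ * (p : ℤ) ^ 2))
    (hrG : GenusTheta.GenusRepresents G (r : ℤ)) :
    (p ≠ 2 →
      GenusTheta.w Δ • ∑ F ∈ G, F.theta =
        ∑ f ∈ g,
          ((GenusTheta.w Δ * ((G.card : ℚ) / (g.card : ℚ))) •
              PowerSeries.expand (p ^ 2) (NeZero.ne (p ^ 2)) f.theta +
            ∑ i ∈ Finset.Icc 1 (p - 1),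
              (((legendreSym p ((r : ℤ) * (i : ℤ)) : ℚ) + 1) / 2) •
                GenusTheta.proj p i f.theta)) ∧
    (p = 2 →
      GenusTheta.w Δ • ∑ F ∈ G, F.theta =
        ∑ f ∈ g,
          ((GenusTheta.w Δ * ((G.card : ℚ) / (g.card : ℚ))) •
              PowerSeries.expand 4 (NeZero.ne 4) f.theta +
            GenusTheta.proj (2 ^ (GenusTheta.t Δ + 1)) r f.theta)) := by
  classical
  have hpr : ¬ (p : ℤ) ∣ (r : ℤ) :=
    GenusTheta.not_dvd_of_isCoprime hr ((dvd_pow_self _ two_ne_zero).mul_left _)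
  have key := GenusTheta.coeff_theta_identity hg hG hcorr hr hrG
  constructor
  · intro h2
    ext n
    simp only [map_sum, map_add, PowerSeries.coeff_smul, PowerSeries.coeff_expand, smul_eq_mul,
      GenusTheta.proj, PowerSeries.coeff_mk]
    rw [key n]
    refine Finset.sum_congr rfl fun C _ => ?_
    rw [GenusTheta.sum_legendreSym_proj_coeff p r n hpr]
    simp only [GenusTheta.GoodValue, if_neg h2]
  · rintro rfl
    ext n
    simp only [map_sum, map_add, PowerSeries.coeff_smul, PowerSeries.coeff_expand, smul_eq_mul,
      GenusTheta.proj, PowerSeries.coeff_mk]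
    rw [key n]
    refine Finset.sum_congr rfl fun C _ => ?_
    have hmod : GenusTheta.GoodValue Δ 2 r n ↔ n ≡ r [MOD 2 ^ (GenusTheta.t Δ + 1)] := by
      rw [GenusTheta.GoodValue, if_pos rfl, ← Int.natCast_modEq_iff]
      push_cast
      rfl
    simp only [hmod]
    norm_num
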